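/- Let $A$ and $B$ be unital $C^*$-algebras. A Lip-norm $L_A$ on $A$ (making $(A,L_A)$ a Lip-normed unital $C^*$-algebra) means a seminorm on a dense real linear subspace $\mathcal D(L_A)\ni 1$ of $A_{\mathrm{sa}}$ such that (1) $L_A(a)=0$ if and only if $a\in\mathbb R1$; (2) the metric $\rho(\mu,\nu)=\sup\{|\mu(a)-\nu(a)| : L_A(a)\le 1\}$ on the state space of the order-unit space $\mathcal D(L_A)$ induces the weak$^*$ topology; (3) $\{a\in\mathcal D(L_A): L_A(a)\le 1\}$ is closed in $A_{\mathrm{sa}}$. Fix such $L_A$ on $A$ and $L_B$ on $B$. Let $UCP_n(A)$ be the set of unital completely positive linear maps $A\to M_n(\mathbb C)$. Let $\mathcal M(L_A,L_B)$ be the set of Lip-norms $L$ on $A\oplus B$ (in the above sense) with domain $\mathcal D(L_A)\oplus\mathcal D(L_B)$ such that $L_A(a)=\inf_{b\in\mathcal D(L_B)} L(a,b)$ for all $a\in\mathcal D(L_A)$ and $L_B(b)=\inf_{a\in\mathcal D(L_A)} L(a,b)$ for all $b\in\mathcal D(L_B)$. For such $L$ put $$\rho_{L,n}(\varphi,\psi)=\sup\{\|\varphi(x)-\psi(x)\|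 : x\in\mathcal D(L),\ L(x)\le 1\}\qquad(\varphi,\psi\in UCP_n(A\oplus B)),$$ and regard $UCP_n(A)$ and $UCP_n(B)$ as subsets of $UCP_n(A\oplus B)$ by composing with the coordinate projections. With $\mathrm{dist}_H^{\rho_{L,n}}$ denoting Hausdorff distance, define $$\mathrm{dist}^n_s(A,B)=\inf_{L\in\mathcal M(L_A,L_B)}\mathrm{dist}_H^{\rho_{L,n}}(UCP_n(A),UCP_n(B)),\qquad \mathrm{dist}_s(A,B)=\inf_{L\in\mathcal M(L_A,L_B)}\ \sup_{n\ge 1}\ \mathrm{dist}_H^{\rho_{L,n}}(UCP_n(A),UCP_n(B)).$$ A bijection $\Phi:A\to B$ is called bi-Lip-isometric if $\Phi(\mathcal D(L_A))\subset\mathcal D(L_B)$ and $L_B(\Phi(a))=L_A(a)$ for all $a\in\mathcal D(L_A)$, and the same holds for $\Phi^{-1}$ with the roles of $A$ and $B$ exchanged. A unital order isomorphism is a unital positive linear bijection with positive inverse. Then: (i) $\mathrm{dist}^1_s(A,B)=0$ if and only if there is a bi-Lip-isometric unital order isomorphism between $A$ and $B$. (ii) For every $n\ge 2$, $\mathrm{dist}^n_s(A,B)=0$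 if and only if there is a bi-Lip-isometric $^*$-isomorphism between $A$ and $B$. (iii) $\mathrm{dist}_s(A,B)=0$ if and only if there is a bi-Lip-isometric $^*$-isomorphism between $A$ and $B$. -/

import Mathlib

open scoped ComplexOrder ENNReal CStarAlgebra

universe u v

noncomputable section

namespace LipQGH

section Basic

variable {A : Type u} [CStarAlgebra A] [PartialOrder A] [StarOrderedRing A]

/-- An order-unit subspace of `A_sa`: a real linear subspace of `A` consisting of self-adjoint
elements and containing the unit, with the order inherited from `A`. -/
structure OrderUnitSubspace (A : Type u) [CStarAlgebra A] where
  toSubmodule : Submodule ℝ A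
  isSelfAdjoint_of_mem : ∀ a ∈ toSubmodule, IsSelfAdjoint a
  one_mem : (1 : A) ∈ toSubmodule

/-- The state space of the order-unit space `D`: positive unital real linear functionals. -/
def StateSpace (D : OrderUnitSubspace A) : Type u :=
  {μ : D.toSubmodule →ₗ[ℝ] ℝ //
    μ ⟨1, D.one_mem⟩ = 1 ∧ ∀ a : D.toSubmodule, 0 ≤ (a : A) → 0 ≤ μ a}

/-- The weak* topology on the state space: the topology of pointwise convergence. -/
@[reducible]
def weakStarTopology (D : OrderUnitSubspace A) : TopologicalSpace (StateSpace D) :=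
  TopologicalSpace.induced (fun (μ : StateSpace D) (a : D.toSubmodule) => μ.1 a) inferInstance

/-- The (a priori extended pseudo-) metric
`ρ_L(μ, ν) = sup {|μ(a) - ν(a)| : a ∈ D, L(a) ≤ 1}` on the state space of `D`. -/
@[reducible]
def stateMetric (D : OrderUnitSubspace A) (L : Seminorm ℝ D.toSubmodule) :
    PseudoEMetricSpace (StateSpace D) where
  edist μ ν := ⨆ (a : D.toSubmodule) (_ : L a ≤ 1), edist (μ.1 a) (ν.1 a)
  edist_self μ := by simp
  edist_comm μ ν := by simp only [edist_comm]
  edist_triangle μ ν κ := by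
    refine iSup₂_le fun a ha => (edist_triangle _ (ν.1 a) _).trans (add_le_add ?_ ?_)
    · exact le_iSup₂ (f := fun (a : D.toSubmodule) (_ : L a ≤ 1) => edist (μ.1 a) (ν.1 a)) a ha
    · exact le_iSup₂ (f := fun (a : D.toSubmodule) (_ : L a ≤ 1) => edist (ν.1 a) (κ.1 a)) a ha

/-- The structure `L` making `(A, L)` a Lip-normed unital C*-algebra: a Lip-norm on a dense
order-unit subspace of `A_sa` whose unit ball is closed in `A_sa`
(equivalently in `A`, because `A_sa` is closed in `A`). -/
structure LipNorm (A : Type u) [CStarAlgebra A] [PartialOrder A] [StarOrderedRing A] where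
  /-- the domain `𝒟(L)` -/
  dom : OrderUnitSubspace A
  dense_dom : ∀ a : A, IsSelfAdjoint a → a ∈ closure (dom.toSubmodule : Set A)
  toSeminorm : Seminorm ℝ dom.toSubmodule
  eq_zero_iff : ∀ a : dom.toSubmodule, toSeminorm a = 0 ↔ ∃ r : ℝ, (a : A) = r • (1 : A)
  topology_eq :
    (stateMetric dom toSeminorm).toUniformSpace.toTopologicalSpace = weakStarTopology dom
  isClosed_ball :
    IsClosed {a : A | ∃ h : a ∈ dom.toSubmodule, toSeminorm ⟨a, h⟩ ≤ 1}

/-- The matrix state space `UCP_n(A)`: unital completely positive linear maps `A → M_n(ℂ)`,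
where `M_n(ℂ)` is the C*-algebra of matrices (with the operator norm). -/
def UCP (n : ℕ) (A : Type u) [CStarAlgebra A] [PartialOrder A] [StarOrderedRing A] : Type u :=
  {φ : A →CP CStarMatrix (Fin n) (Fin n) ℂ // φ 1 = 1}

/-- The metric `ρ_{L,n}(φ, ψ) = sup {‖φ(x) - ψ(x)‖ : x ∈ 𝒟(L), L(x) ≤ 1}` on `UCP_n(A)`. -/
@[reducible]
def LipNorm.ucpMetric (L : LipNorm A) (n : ℕ) : PseudoEMetricSpace (UCP n A) where
  edist φ ψ := ⨆ (x : L.dom.toSubmodule) (_ : L.toSeminorm x ≤ 1), edist (φ.1 (x : A)) (ψ.1 (x : A))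
  edist_self φ := by simp
  edist_comm φ ψ := by simp only [edist_comm]
  edist_triangle φ ψ χ := by
    refine iSup₂_le fun a ha => (edist_triangle _ (ψ.1 (a : A)) _).trans (add_le_add ?_ ?_)
    · exact le_iSup₂ (f := fun (a : L.dom.toSubmodule) (_ : L.toSeminorm a ≤ 1) =>
        edist (φ.1 (a : A)) (ψ.1 (a : A))) a ha
    · exact le_iSup₂ (f := fun (a : L.dom.toSubmodule) (_ : L.toSeminorm a ≤ 1) =>
        edist (ψ.1 (a : A)) (χ.1 (a : A))) a ha

end Basic

section Pair

variable {A : Type u} [CStarAlgebra A] [PartialOrder A] [StarOrderedRing A]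
variable {B : Type v} [CStarAlgebra B] [PartialOrder B] [StarOrderedRing B]

/-- Composition of a u.c.p. map with a unital *-homomorphism. -/
def UCP.comp {n : ℕ} (φ : UCP n B) (π : A →⋆ₐ[ℂ] B) : UCP n A :=
  ⟨{ toLinearMap := (φ.1 : B →ₗ[ℂ] CStarMatrix (Fin n) (Fin n) ℂ) ∘ₗ (π : A →ₗ[ℂ] B)
     map_cstarMatrix_nonneg' := fun k M hM =>
       φ.1.map_cstarMatrix_nonneg' k (M.map π)
         (CompletelyPositiveMapClass.map_cstarMatrix_nonneg' π k M hM) },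
    (congrArg φ.1 (map_one π)).trans φ.2⟩

/-- `UCP_n(A)` as a subset of `UCP_n(A ⊕ B)`, via `φ ↦ ((a, b) ↦ φ(a))`. -/
def ucpLeft (A : Type u) [CStarAlgebra A] [PartialOrder A] [StarOrderedRing A]
    (B : Type v) [CStarAlgebra B] [PartialOrder B] [StarOrderedRing B] (n : ℕ) :
    Set (UCP n (A × B)) :=
  Set.range fun φ : UCP n A => φ.comp (StarAlgHom.fst ℂ A B)

/-- `UCP_n(B)` as a subset of `UCP_n(A ⊕ B)`, via `ψ ↦ ((a, b) ↦ ψ(b))`. -/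
def ucpRight (A : Type u) [CStarAlgebra A] [PartialOrder A] [StarOrderedRing A]
    (B : Type v) [CStarAlgebra B] [PartialOrder B] [StarOrderedRing B] (n : ℕ) :
    Set (UCP n (A × B)) :=
  Set.range fun ψ : UCP n B => ψ.comp (StarAlgHom.snd ℂ A B)

/-- `L ∈ ℳ(L_A, L_B)`: `L` is a closed Lip-norm with domain `𝒟(L_A) ⊕ 𝒟(L_B)` such that `L_A`
and `L_B` are the quotient seminorms of `L` under the two coordinate projections. -/
structure Induces (L : LipNorm (A × B)) (LA : LipNorm A) (LB : LipNorm B) : Prop where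
  mem_dom_iff : ∀ p : A × B,
    p ∈ L.dom.toSubmodule ↔ p.1 ∈ LA.dom.toSubmodule ∧ p.2 ∈ LB.dom.toSubmodule
  quotient_left : ∀ a : LA.dom.toSubmodule,
    IsGLB {r : ℝ | ∃ p : L.dom.toSubmodule, (p : A × B).1 = a ∧ L.toSeminorm p = r}
      (LA.toSeminorm a)
  quotient_right : ∀ b : LB.dom.toSubmodule,
    IsGLB {r : ℝ | ∃ p : L.dom.toSubmodule, (p : A × B).2 = b ∧ L.toSeminorm p = r}
      (LB.toSeminorm b)

/-- The Hausdorff distance between `UCP_n(A)` and `UCP_n(B)` with respect to `ρ_{L,n}`. -/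
def LipNorm.ucpHausdorff (L : LipNorm (A × B)) (n : ℕ) : ℝ≥0∞ :=
  @Metric.hausdorffEDist (UCP n (A × B)) (L.ucpMetric n) (ucpLeft A B n) (ucpRight A B n)

/-- The `n`-distance `dist^n_s`. -/
def nDist (n : ℕ) (LA : LipNorm A) (LB : LipNorm B) : ℝ≥0∞ :=
  ⨅ (L : LipNorm (A × B)) (_ : Induces L LA LB), L.ucpHausdorff n

/-- The complete distance `dist_s`. -/
def completeDist (LA : LipNorm A) (LB : LipNorm B) : ℝ≥0∞ :=
  ⨅ (L : LipNorm (A × B)) (_ : Induces L LA LB), ⨆ (n : ℕ) (_ : 1 ≤ n), L.ucpHausdorff n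

/-- A unital order isomorphism: a unital positive linear bijection with positive inverse. -/
structure IsUnitalOrderIso (Φ : A ≃ₗ[ℂ] B) : Prop where
  map_one : Φ 1 = 1
  map_nonneg : ∀ a : A, 0 ≤ a → 0 ≤ Φ a
  symm_map_nonneg : ∀ b : B, 0 ≤ b → 0 ≤ Φ.symm b

/-- `f` maps `𝒟(L_A)` into `𝒟(L_B)` and `L_B(f(a)) = L_A(a)` for all `a ∈ 𝒟(L_A)`. -/
def LipIsometric (LA : LipNorm A) (LB : LipNorm B) (f : A → B) : Prop :=
  ∀ a : LA.dom.toSubmodule, ∃ h : f a ∈ LB.dom.toSubmodule,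
    LB.toSeminorm ⟨f a, h⟩ = LA.toSeminorm a

/-- Both `f` and its inverse are Lip-isometric. -/
def BiLipIsometric (LA : LipNorm A) (LB : LipNorm B) (f : A ≃ B) : Prop :=
  LipIsometric LA LB f ∧ LipIsometric LB LA f.symm

end Pair

end LipQGH

end

/-!
The three equivalences share one mechanism. Call the relation `L(a, b) ≤ C`, for a Lip-norm `L`
inducing `L_A` and `L_B`, a *bridge* of width `ε` when the two sets of unital completely positive
(u.c.p.) maps into `Mₙ(ℂ)` are within `ε` of each other (`IsBridge`). Since states
detect the norm of self-adjoint elements, a bridge of width `ε` satisfies `|‖a‖ - ‖b‖| ≤ ε C`.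

*Vanishing distance yields an isomorphism.* The distance is an infimum which need not be attained,
so one takes bridges of width `1 / (k + 1)` and passes to the limit along a free ultrafilter on `ℕ`.
Lip-balls of bounded norm are norm compact (`LipNorm.isCompact_le`), so every `a ∈ 𝒟(L_A)` has a
limit partner `b` with `L_B(b) ≤ L_A(a)`, and conversely (`IsBridgeSeq.exists_limRel_right`). The
limit relation is linear, isometric and contains `(1, 1)`; its closure is the graph of a unital
isometry between the self-adjoint parts. A self-adjoint `x` is positive exactly when
`‖‖x‖ • 1 - x‖ ≤ ‖x‖`, so the complex-linear extension `Φ` is a unital order isomorphism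
(`IsBridgeSeq.exists_linearEquiv`).

*Multiplicativity for `n ≥ 2`.* Every `ψ ∘ Φ`, with `ψ` u.c.p. on `B`, is a pointwise limit of
u.c.p. maps on `A`, and therefore satisfies the Kadison–Schwarz inequality. For a state `μ` of `B`
and `y ∈ B` there is a u.c.p. map `ψ : B → Mₙ(ℂ)` with `μ` as a diagonal entry and with the whole of
`μ(y* y)` in the corresponding column of `ψ(y)` (`exists_ucp_le_sum_norm_sq`). With `y = Φ(a)` this
gives `Φ(a)* Φ(a) ≤ Φ(a* a)` without any appeal to the duality between u.c.p. maps and positive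
matrices. The same inequality for `Φ⁻¹` and polarization give `Φ(a b) = Φ(a) Φ(b)`.

*An isomorphism yields vanishing distance.* For a bi-Lip-isometric `Φ` and `ε > 0` the seminorm
`max(L_A(a), L_B(b), ‖Φ(a) - b‖ / ε)` belongs to `ℳ(L_A, L_B)` (`bridgeLipNorm`), and `ψ ∘ Φ` is
`ε`-close to `ψ`. That the metric of this seminorm induces the weak* topology follows
from a criterion in terms of total boundedness (`StateSpace.topology_eq_of_totallyBounded`), whose
hypotheses are inherited from the Lip-balls of `A` and `B`. For `n = 1` the composition `ψ ∘ Φ` is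
completely positive because positive functionals are; for all `n` this holds when `Φ` is
a `*`-isomorphism.
-/

noncomputable section

namespace LipQGH

/-! ### States of a C*-algebra -/

section States

variable {A : Type u} [CStarAlgebra A] [PartialOrder A] [StarOrderedRing A]

theorem norm_le_of_neg_le_of_le {x : A} (hx : IsSelfAdjoint x) {c : ℝ} (hc : 0 ≤ c)
    (h₁ : -(c • (1 : A)) ≤ x) (h₂ : x ≤ c • (1 : A)) : ‖x‖ ≤ c := by
  rcases subsingleton_or_nontrivial A with hA | hA
  · simpa [Subsingleton.elim x 0] using hc
  · rw [← Algebra.algebraMap_eq_smul_one] at h₁ h₂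
    rw [← map_neg] at h₁
    rcases CStarAlgebra.norm_or_neg_norm_mem_spectrum hx with h | h
    · exact (le_algebraMap_iff_spectrum_le (ha := hx)).1 h₂ _ h
    · exact neg_le_neg_iff.1 ((algebraMap_le_iff_le_spectrum (ha := hx)).1 h₁ _ h)

/-- Positivity of a self-adjoint element in terms of norms and the unit only; hence unital
isometries of self-adjoint parts preserve positivity. -/
theorem nonneg_iff_norm_smul_one_sub_le {x : A} (hx : IsSelfAdjoint x) :
    0 ≤ x ↔ ‖‖x‖ • (1 : A) - x‖ ≤ ‖x‖ := by
  rw [← Algebra.algebraMap_eq_smul_one]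
  constructor
  · intro h
    have h₁ : 0 ≤ algebraMap ℝ A ‖x‖ - x := sub_nonneg.2 hx.le_algebraMap_norm_self
    rw [CStarAlgebra.norm_le_iff_le_algebraMap _ (norm_nonneg x) h₁]
    exact sub_le_self _ h
  · intro h
    have h₁ : IsSelfAdjoint (algebraMap ℝ A ‖x‖ - x) :=
      (IsSelfAdjoint.algebraMap A (IsSelfAdjoint.all _)).sub hx
    have h₂ := h₁.le_algebraMap_norm_self.trans (algebraMap_mono A h)
    simpa using h₂

/-- The real-linear functional `x ↦ f (Re x)`. -/
def compRealPart (f : A →ₗ[ℝ] ℝ) : A →ₗ[ℝ] ℝ where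
  toFun x := f (realPart x : A)
  map_add' x y := by simp
  map_smul' r x := by simp

/-- The complex-linear positive functional which agrees with `f` on self-adjoint elements. -/
def complexify (f : A →ₗ[ℝ] ℝ) (hf : ∀ x, 0 ≤ x → 0 ≤ f x) : A →ₚ[ℂ] ℂ :=
  PositiveLinearMap.mk₀ (Module.Dual.extendRCLike (𝕜 := ℂ) (compRealPart f)) fun x hx => by
    have h : IsSelfAdjoint x := .of_nonneg hx
    simpa [Module.Dual.extendRCLike_apply, compRealPart, realPart_I_smul, h.imaginaryPart,
      h.coe_realPart] using hf x hx

theorem complexify_apply (f : A →ₗ[ℝ] ℝ) (hf : ∀ x, 0 ≤ x → 0 ≤ f x) {x : A}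
    (hx : IsSelfAdjoint x) : complexify f hf x = f x := by
  change Module.Dual.extendRCLike (𝕜 := ℂ) (compRealPart f) x = _
  simp [Module.Dual.extendRCLike_apply, compRealPart, realPart_I_smul, hx.imaginaryPart,
    hx.coe_realPart]

/-- States detect positivity: a self-adjoint element outside the closed cone of positive elements
is separated from it by a real functional, which is then normalised at `1`. -/
theorem exists_state_re_neg {b : A} (hb : IsSelfAdjoint b) (h : ¬ 0 ≤ b) :
    ∃ μ : A →ₚ[ℂ] ℂ, μ 1 = 1 ∧ (μ b).re < 0 := by
  obtain ⟨f, hf, hfb⟩ := (ProperCone.positive ℝ A).hyperplane_separation_point (x₀ := b) (by simpa)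
  simp only [ProperCone.mem_positive] at hf
  -- `f b < 0 ≤ f (b + ‖b‖ • 1)` forces `f 1 > 0`
  have h1 : 0 < f 1 := by
    have h₁ : 0 ≤ b + ‖b‖ • (1 : A) := by
      have := hb.neg_algebraMap_norm_le_self
      rw [Algebra.algebraMap_eq_smul_one] at this
      simpa using sub_nonneg.2 this
    have h₂ := hf _ h₁
    rw [map_add, map_smul, smul_eq_mul] at h₂
    have h₃ : 0 < ‖b‖ * f 1 := by linarith
    exact pos_of_mul_pos_right h₃ (norm_nonneg b)
  have hg : ∀ x, 0 ≤ x → 0 ≤ ((f 1)⁻¹ • (f : A →ₗ[ℝ] ℝ)) x := fun x hx => by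
    simpa using mul_nonneg (inv_nonneg.2 h1.le) (hf x hx)
  refine ⟨complexify ((f 1)⁻¹ • (f : A →ₗ[ℝ] ℝ)) hg, ?_, ?_⟩
  · rw [complexify_apply _ _ (IsSelfAdjoint.one A)]
    simp [h1.ne']
  · rw [complexify_apply _ _ hb]
    simpa using mul_neg_of_pos_of_neg (inv_pos.2 h1) hfb

theorem nonneg_of_forall_state {b : A} (hb : IsSelfAdjoint b)
    (h : ∀ μ : A →ₚ[ℂ] ℂ, μ 1 = 1 → 0 ≤ (μ b).re) : 0 ≤ b := by
  by_contra hn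
  obtain ⟨μ, h1, h2⟩ := exists_state_re_neg hb hn
  exact h2.not_ge (h μ h1)

theorem norm_le_of_forall_state {b : A} (hb : IsSelfAdjoint b) {c : ℝ} (hc : 0 ≤ c)
    (h : ∀ μ : A →ₚ[ℂ] ℂ, μ 1 = 1 → |(μ b).re| ≤ c) : ‖b‖ ≤ c := by
  have hc1 : IsSelfAdjoint (c • (1 : A)) := (IsSelfAdjoint.all c).smul (IsSelfAdjoint.one A)
  refine norm_le_of_neg_le_of_le hb hc ?_ ?_
  · rw [neg_le_iff_add_nonneg, add_comm]
    refine nonneg_of_forall_state (hc1.add hb) fun μ h1 => ?_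
    have := (abs_le.1 (h μ h1)).1
    rw [map_add, ← Complex.coe_smul, map_smul, h1]
    simp
    linarith
  · rw [← sub_nonneg]
    refine nonneg_of_forall_state (hc1.sub hb) fun μ h1 => ?_
    have := (abs_le.1 (h μ h1)).2
    rw [map_sub, ← Complex.coe_smul, map_smul, h1]
    simp
    linarith

variable {B : Type v} [CStarAlgebra B] [PartialOrder B] [StarOrderedRing B]

/-- Unital positive maps are contractive on self-adjoint elements. -/
theorem norm_map_le_of_isSelfAdjoint {F : Type*} [FunLike F A B] [LinearMapClass F ℂ A B]
    [OrderHomClass F A B] (φ : F) (h1 : φ 1 = 1) {x : A} (hx : IsSelfAdjoint x) :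
    ‖φ x‖ ≤ ‖x‖ := by
  have hs : φ (‖x‖ • (1 : A)) = ‖x‖ • (1 : B) := by
    rw [← Complex.coe_smul, map_smul, h1, Complex.coe_smul]
  refine norm_le_of_neg_le_of_le (hx.map' φ) (norm_nonneg x) ?_ ?_
  · rw [← hs, ← map_neg]
    refine OrderHomClass.mono φ ?_
    simpa [Algebra.algebraMap_eq_smul_one] using hx.neg_algebraMap_norm_le_self
  · rw [← hs]
    refine OrderHomClass.mono φ ?_
    simpa [Algebra.algebraMap_eq_smul_one] using hx.le_algebraMap_norm_self

/-- Unital positive maps have norm at most `2`; this crude bound does not depend on the map. -/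
theorem norm_map_le_two_mul {F : Type*} [FunLike F A B] [LinearMapClass F ℂ A B]
    [OrderHomClass F A B] (φ : F) (h1 : φ 1 = 1) (x : A) : ‖φ x‖ ≤ 2 * ‖x‖ := by
  conv_lhs => rw [← realPart_add_I_smul_imaginaryPart x, map_add, map_smul]
  refine (norm_add_le _ _).trans ?_
  rw [norm_smul, Complex.norm_I, one_mul, two_mul]
  exact add_le_add
    ((norm_map_le_of_isSelfAdjoint φ h1 (realPart x).2).trans (realPart.norm_le x))
    ((norm_map_le_of_isSelfAdjoint φ h1 (imaginaryPart x).2).trans (imaginaryPart.norm_le x))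

end States

/-! ### Lip-norms: compactness of Lip-balls and the weak* topology -/

section LipNorm

open Filter Topology

theorem StateSpace.edist_le_iff {E : Type*} [CStarAlgebra E] [PartialOrder E]
    {D : OrderUnitSubspace E} (L : Seminorm ℝ D.toSubmodule) {μ ν : StateSpace D} {ε : ℝ}
    (hε : 0 ≤ ε) : (stateMetric D L).edist μ ν ≤ ENNReal.ofReal ε ↔
      ∀ a : D.toSubmodule, L a ≤ 1 → |μ.1 a - ν.1 a| ≤ ε := by
  change (⨆ (a : D.toSubmodule) (_ : L a ≤ 1), edist (μ.1 a) (ν.1 a)) ≤ _ ↔ _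
  simp only [iSup_le_iff, edist_dist, Real.dist_eq, ENNReal.ofReal_le_ofReal_iff hε]

variable {A : Type u} [CStarAlgebra A] [PartialOrder A] [StarOrderedRing A]

/-- `L.Le a C` says that `a ∈ 𝒟(L)` and `L(a) ≤ C`. -/
def LipNorm.Le (L : LipNorm A) (a : A) (C : ℝ) : Prop :=
  ∃ h : a ∈ L.dom.toSubmodule, L.toSeminorm ⟨a, h⟩ ≤ C

namespace LipNorm

variable {L : LipNorm A} {a b : A} {C C' : ℝ}

theorem le_of_mem (L : LipNorm A) (a : L.dom.toSubmodule) : L.Le (a : A) (L.toSeminorm a) :=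
  ⟨a.2, le_rfl⟩

theorem Le.mem (h : L.Le a C) : a ∈ L.dom.toSubmodule := h.1

theorem Le.isSelfAdjoint (h : L.Le a C) : IsSelfAdjoint a := L.dom.isSelfAdjoint_of_mem a h.1

theorem Le.mono (h : L.Le a C) (hC : C ≤ C') : L.Le a C' := ⟨h.1, h.2.trans hC⟩

theorem Le.add (h : L.Le a C) (h' : L.Le b C') : L.Le (a + b) (C + C') :=
  ⟨add_mem h.1 h'.1, (map_add_le_add L.toSeminorm ⟨a, h.1⟩ ⟨b, h'.1⟩).trans (add_le_add h.2 h'.2)⟩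

theorem Le.smul (h : L.Le a C) (r : ℝ) : L.Le (r • a) (|r| * C) :=
  ⟨Submodule.smul_mem _ r h.1, (map_smul_eq_mul L.toSeminorm r ⟨a, h.1⟩).le.trans
    (mul_le_mul_of_nonneg_left h.2 (abs_nonneg r))⟩

theorem le_smul_one (L : LipNorm A) (r : ℝ) : L.Le (r • (1 : A)) 0 :=
  ⟨Submodule.smul_mem _ r L.dom.one_mem, ((L.eq_zero_iff _).2 ⟨r, rfl⟩).le⟩

theorem isClosed_le (L : LipNorm A) (hC : 0 < C) : IsClosed {a : A | L.Le a C} := by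
  have : {a : A | L.Le a C} = (fun a : A => C⁻¹ • a) ⁻¹'
      {a : A | ∃ h : a ∈ L.dom.toSubmodule, L.toSeminorm ⟨a, h⟩ ≤ 1} := by
    ext a
    constructor
    · intro h
      have := h.smul C⁻¹
      rwa [abs_of_pos (inv_pos.2 hC), inv_mul_cancel₀ hC.ne'] at this
    · intro h
      have := Le.smul (L := L) (a := C⁻¹ • a) (C := 1) h C
      rwa [smul_smul, mul_inv_cancel₀ hC.ne', one_smul, mul_one, abs_of_pos hC] at this
  rw [this]
  exact L.isClosed_ball.preimage (continuous_const_smul _)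

end LipNorm

namespace StateSpace

variable {D : OrderUnitSubspace A}

theorem abs_apply_le (μ : StateSpace D) (a : D.toSubmodule) : |μ.1 a| ≤ ‖(a : A)‖ := by
  have ha := D.isSelfAdjoint_of_mem a a.2
  have hpos : ∀ b : D.toSubmodule, (b : A) = ‖(a : A)‖ • (1 : A) - a → μ.1 b = ‖(a : A)‖ - μ.1 a :=
    fun b hb => by
      have : b = ‖(a : A)‖ • (⟨1, D.one_mem⟩ : D.toSubmodule) - a := Subtype.ext (by simpa using hb)
      rw [this, map_sub, map_smul, μ.2.1, smul_eq_mul, mul_one]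
  have hneg : ∀ b : D.toSubmodule, (b : A) = ‖(a : A)‖ • (1 : A) + a → μ.1 b = ‖(a : A)‖ + μ.1 a :=
    fun b hb => by
      have : b = ‖(a : A)‖ • (⟨1, D.one_mem⟩ : D.toSubmodule) + a := Subtype.ext (by simpa using hb)
      rw [this, map_add, map_smul, μ.2.1, smul_eq_mul, mul_one]
  have h₁ := ha.le_algebraMap_norm_self
  have h₂ := ha.neg_algebraMap_norm_le_self
  rw [Algebra.algebraMap_eq_smul_one] at h₁ h₂
  have hmem : ‖(a : A)‖ • (1 : A) ∈ D.toSubmodule := Submodule.smul_mem _ _ D.one_mem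
  have e₁ := μ.2.2 ⟨_, sub_mem hmem a.2⟩ (sub_nonneg.2 h₁)
  have e₂ := μ.2.2 ⟨_, add_mem hmem a.2⟩ (neg_le_iff_add_nonneg'.1 h₂)
  rw [hpos _ rfl] at e₁
  rw [hneg _ rfl] at e₂
  exact abs_le.2 ⟨by linarith, by linarith⟩

/-- The restriction of a state of `A` to an order-unit subspace. -/
def ofState (D : OrderUnitSubspace A) (μ : A →ₚ[ℂ] ℂ) (h1 : μ 1 = 1) : StateSpace D :=
  ⟨{ toFun := fun a => (μ (a : A)).re
     map_add' := fun a b => by simp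
     map_smul' := fun r a => by
      rw [SetLike.val_smul, ← Complex.coe_smul, map_smul]
      simp },
    by simp [h1], fun a ha => (Complex.le_def.1 (map_nonneg μ ha)).1⟩

theorem norm_le_of_forall (a : D.toSubmodule) {c : ℝ} (hc : 0 ≤ c)
    (h : ∀ μ : StateSpace D, |μ.1 a| ≤ c) : ‖(a : A)‖ ≤ c :=
  norm_le_of_forall_state (D.isSelfAdjoint_of_mem a a.2) hc fun μ h1 => h (ofState D μ h1)

/-- The state space is a closed subset of a product of intervals, hence weak* compact. -/
theorem compactSpace (D : OrderUnitSubspace A) :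
    @CompactSpace (StateSpace D) (weakStarTopology D) := by
  let := weakStarTopology D
  have hind : IsInducing (fun (μ : StateSpace D) (a : D.toSubmodule) => μ.1 a) := ⟨rfl⟩
  have hrange : Set.range (fun (μ : StateSpace D) (a : D.toSubmodule) => μ.1 a) =
      (Set.univ.pi fun a : D.toSubmodule => Set.Icc (-‖(a : A)‖) ‖(a : A)‖) ∩
      ((⋂ (a : D.toSubmodule) (b : D.toSubmodule), {f | f (a + b) = f a + f b}) ∩
       (⋂ (r : ℝ) (a : D.toSubmodule), {f | f (r • a) = r * f a}) ∩
       ({f | f ⟨1, D.one_mem⟩ = 1} ∩ ⋂ (a : D.toSubmodule) (_ : 0 ≤ (a : A)), {f | 0 ≤ f a})) := by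
    ext f
    constructor
    · rintro ⟨μ, rfl⟩
      refine ⟨fun a _ => abs_le.1 (abs_apply_le μ a), ⟨?_, ?_⟩, μ.2.1, ?_⟩
      · simp
      · simp
      · simpa using μ.2.2
    · rintro ⟨-, ⟨hadd, hsmul⟩, h1, hpos⟩
      simp only [Set.mem_iInter, Set.mem_ofPred_eq] at hadd hsmul h1 hpos
      exact ⟨⟨{ toFun := f, map_add' := hadd, map_smul' := hsmul }, h1, hpos⟩, rfl⟩
  have hc : IsCompact (Set.range fun (μ : StateSpace D) (a : D.toSubmodule) => μ.1 a) := by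
    rw [hrange]
    refine (isCompact_univ_pi fun a => isCompact_Icc).inter_right ?_
    refine IsClosed.inter (IsClosed.inter ?_ ?_) (IsClosed.inter ?_ ?_)
    · exact isClosed_iInter fun a => isClosed_iInter fun b =>
        isClosed_eq (by fun_prop) (by fun_prop)
    · exact isClosed_iInter fun a => isClosed_iInter fun b =>
        isClosed_eq (by fun_prop) (by fun_prop)
    · exact isClosed_eq (by fun_prop) (by fun_prop)
    · exact isClosed_iInter fun a => isClosed_iInter fun _ =>
        _root_.isClosed_le (by fun_prop) (by fun_prop)
  refine ⟨?_⟩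
  rw [hind.isCompact_iff, Set.image_univ]
  exact hc

/-- Total boundedness and boundedness modulo scalars of the unit ball of `L` force the metric
`ρ_L` to induce the weak* topology. -/
theorem topology_eq_of_totallyBounded (D : OrderUnitSubspace A) (L : Seminorm ℝ D.toSubmodule)
    (hone : ∀ r : ℝ, L (r • ⟨1, D.one_mem⟩) = 0)
    (htb : ∀ R : ℝ, TotallyBounded
      {a : A | (∃ h : a ∈ D.toSubmodule, L ⟨a, h⟩ ≤ 1) ∧ ‖a‖ ≤ R})
    (hbdd : ∃ R : ℝ, ∀ a : D.toSubmodule, L a ≤ 1 → ∃ r : ℝ, ‖(a : A) - r • 1‖ ≤ R) :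
    (stateMetric D L).toUniformSpace.toTopologicalSpace = weakStarTopology D := by
  refine TopologicalSpace.ext_nhds fun μ => le_antisymm ?_ ?_
  · have hcont : @Continuous _ _ (stateMetric D L).toUniformSpace.toTopologicalSpace _
        (fun (μ : StateSpace D) (a : D.toSubmodule) => μ.1 a) := by
      let := stateMetric D L
      refine continuous_pi fun a => ?_
      have hL : 0 < L a + 1 := by have := apply_nonneg L a; linarith
      have hlip : LipschitzWith (Real.toNNReal (L a + 1)) (fun μ : StateSpace D => μ.1 a) := by
        intro μ ν
        have ha : L ((L a + 1)⁻¹ • a) ≤ 1 := by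
          rw [map_smul_eq_mul, Real.norm_eq_abs, abs_of_pos (inv_pos.2 hL), inv_mul_le_iff₀ hL]
          linarith
        have h1 : edist (μ.1 ((L a + 1)⁻¹ • a)) (ν.1 ((L a + 1)⁻¹ • a)) ≤ edist μ ν :=
          le_iSup₂ (f := fun (a : D.toSubmodule) (_ : L a ≤ 1) => edist (μ.1 a) (ν.1 a)) _ ha
        have h2 : edist (μ.1 a) (ν.1 a) = (Real.toNNReal (L a + 1) : ℝ≥0∞) *
            edist (μ.1 ((L a + 1)⁻¹ • a)) (ν.1 ((L a + 1)⁻¹ • a)) := by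
          rw [edist_dist, edist_dist, Real.dist_eq, Real.dist_eq, map_smul, map_smul,
            ← smul_sub, smul_eq_mul, abs_mul, abs_of_pos (inv_pos.2 hL)]
          change _ = ENNReal.ofReal (L a + 1) * _
          rw [← ENNReal.ofReal_mul hL.le, ← mul_assoc, mul_inv_cancel₀ hL.ne', one_mul]
        rw [h2]
        gcongr
      exact hlip.continuous
    exact (continuous_iff_le_induced.1 hcont) |> fun h => nhds_mono h
  · obtain ⟨R, hR⟩ := hbdd
    have hbasis := @Metric.nhds_basis_closedEBall _ (stateMetric D L) μ
    rw [hbasis.ge_iff]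
    intro ε hε
    obtain ⟨δ, hδ0, hδ⟩ : ∃ δ : ℝ, 0 < δ ∧ ENNReal.ofReal (3 * δ) ≤ ε := by
      rcases eq_or_ne ε ⊤ with rfl | hε'
      · exact ⟨1, one_pos, le_top⟩
      · refine ⟨ε.toReal / 3, by have := ENNReal.toReal_pos hε.ne' hε'; positivity, ?_⟩
        rw [mul_div_cancel₀ _ (by norm_num : (3 : ℝ) ≠ 0), ENNReal.ofReal_toReal hε']
    obtain ⟨t, hts, htf, ht⟩ := Metric.finite_approx_of_totallyBounded (htb R) δ hδ0
    -- it suffices to be weak*-close to `μ` on the finite `δ`-net `t`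
    have hev : ∀ᶠ ν in @nhds _ (weakStarTopology D) μ,
        ∀ x ∈ t, ∀ h : x ∈ D.toSubmodule, |ν.1 ⟨x, h⟩ - μ.1 ⟨x, h⟩| < δ := by
      rw [eventually_all_finite htf]
      intro x hx
      obtain ⟨⟨h, -⟩, -⟩ := hts hx
      let := weakStarTopology D
      have hc : Continuous fun ν : StateSpace D => ν.1 ⟨x, h⟩ :=
        (continuous_apply (⟨x, h⟩ : D.toSubmodule)).comp continuous_induced_dom
      have := (hc.tendsto μ).eventually (Metric.ball_mem_nhds (μ.1 ⟨x, h⟩) hδ0)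
      filter_upwards [this] with ν hν _
      simpa [Real.dist_eq] using hν
    filter_upwards [hev] with ν hν
    refine le_trans ((edist_le_iff L (by positivity)).2 fun a ha => ?_) hδ
    obtain ⟨r, hr⟩ := hR a ha
    -- states agree on scalars, so `a` may be replaced by its bounded translate `a'`
    set a' : D.toSubmodule := a - r • ⟨1, D.one_mem⟩ with ha'
    have hLa' : L a' ≤ 1 := by
      refine (map_sub_le_add L _ _).trans ?_
      rw [hone, add_zero]
      exact ha
    have hmem : (a' : A) ∈ ⋃ y ∈ t, Metric.ball y δ := ht ⟨⟨a'.2, hLa'⟩, by simpa [ha'] using hr⟩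
    simp only [Set.mem_iUnion, Metric.mem_ball, dist_eq_norm] at hmem
    obtain ⟨x, hx, hxd⟩ := hmem
    obtain ⟨⟨hxD, -⟩, -⟩ := hts hx
    have h₁ := abs_le.1 (abs_apply_le ν (a' - ⟨x, hxD⟩))
    have h₂ := abs_le.1 (abs_apply_le μ (a' - ⟨x, hxD⟩))
    have h₃ := abs_lt.1 (hν x hx hxD)
    have h₄ : ν.1 a - μ.1 a = ν.1 a' - μ.1 a' := by
      rw [ha', map_sub, map_sub, map_smul, map_smul, ν.2.1, μ.2.1]
      ring
    simp only [map_sub, AddSubgroupClass.coe_sub] at h₁ h₂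
    rw [h₄, abs_le]
    constructor <;> linarith [h₁.1, h₁.2, h₂.1, h₂.2, h₃.1, h₃.2]

end StateSpace

namespace LipNorm

/-- Every `ρ_L`-ball is a weak* neighbourhood of its centre. -/
theorem eventually_abs_sub_le (L : LipNorm A) (μ : StateSpace L.dom) {ε : ℝ} (hε : 0 < ε) :
    ∀ᶠ ν in @nhds _ (weakStarTopology L.dom) μ,
      ∀ a : L.dom.toSubmodule, L.toSeminorm a ≤ 1 → |ν.1 a - μ.1 a| ≤ ε := by
  have h := (@Metric.nhds_basis_closedEBall _ (stateMetric L.dom L.toSeminorm) μ).mem_of_mem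
    (ENNReal.ofReal_pos.2 hε)
  rw [L.topology_eq] at h
  filter_upwards [h] with ν hν
  exact (StateSpace.edist_le_iff L.toSeminorm hε.le).1 hν

/-- The state space is totally bounded for `ρ_L`, because it is weak* compact. -/
theorem exists_finite_net (L : LipNorm A) {ε : ℝ} (hε : 0 < ε) :
    ∃ t : Finset (StateSpace L.dom), ∀ μ : StateSpace L.dom, ∃ ν ∈ t,
      ∀ a : L.dom.toSubmodule, L.toSeminorm a ≤ 1 → |μ.1 a - ν.1 a| ≤ ε := by
  let := weakStarTopology L.dom
  have := StateSpace.compactSpace L.dom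
  obtain ⟨t, -, ht⟩ := (isCompact_univ (X := StateSpace L.dom)).elim_nhds_subcover
    (fun ν => {μ | ∀ a : L.dom.toSubmodule, L.toSeminorm a ≤ 1 → |μ.1 a - ν.1 a| ≤ ε})
    fun ν _ => L.eventually_abs_sub_le ν hε
  refine ⟨t, fun μ => ?_⟩
  simpa using ht (Set.mem_univ μ)

/-- Any two states are at finite distance: the segment joining them is weak*-continuous, and along
it the distance to an endpoint is proportional to the parameter. -/
theorem exists_abs_sub_le (L : LipNorm A) (μ ν : StateSpace L.dom) :
    ∃ K : ℝ, ∀ a : L.dom.toSubmodule, L.toSeminorm a ≤ 1 → |ν.1 a - μ.1 a| ≤ K := by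
  let := weakStarTopology L.dom
  let γ : unitInterval → StateSpace L.dom := fun t =>
    ⟨(1 - (t : ℝ)) • μ.1 + (t : ℝ) • ν.1, by simp [μ.2.1, ν.2.1], fun a ha => by
      simpa using add_nonneg (mul_nonneg (sub_nonneg.2 t.2.2) (μ.2.2 a ha))
        (mul_nonneg t.2.1 (ν.2.2 a ha))⟩
  have hγ : Continuous γ := by
    refine continuous_induced_rng.2 (continuous_pi fun a => ?_)
    change Continuous fun t : unitInterval => (1 - (t : ℝ)) * μ.1 a + (t : ℝ) * ν.1 a
    fun_prop
  have hγ0 : γ 0 = μ := Subtype.ext (by simp [γ])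
  have hev := (hγ0 ▸ hγ.tendsto 0).eventually (L.eventually_abs_sub_le μ one_pos)
  obtain ⟨t, ht, ht0⟩ : ∃ t : unitInterval, (∀ a : L.dom.toSubmodule, L.toSeminorm a ≤ 1 →
      |(γ t).1 a - μ.1 a| ≤ 1) ∧ t ≠ 0 := by
    obtain ⟨δ, hδ, h⟩ := Metric.eventually_nhds_iff.1 hev
    have hm : 0 < min (δ / 2) 1 := lt_min (by positivity) one_pos
    refine ⟨⟨min (δ / 2) 1, hm.le, min_le_right _ _⟩, h ?_,
      fun h0 => hm.ne' (congrArg Subtype.val h0)⟩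
    rw [Subtype.dist_eq, Real.dist_eq, Set.Icc.coe_zero, sub_zero, abs_of_pos hm]
    exact (min_le_left _ _).trans_lt (by linarith)
  have ht' : 0 < (t : ℝ) := lt_of_le_of_ne t.2.1 fun h => ht0 (Subtype.ext h.symm)
  refine ⟨(t : ℝ)⁻¹, fun a ha => ?_⟩
  have h := ht a ha
  have e : (γ t).1 a - μ.1 a = (t : ℝ) * (ν.1 a - μ.1 a) := by
    change (1 - (t : ℝ)) * μ.1 a + (t : ℝ) * ν.1 a - μ.1 a = _
    ring
  rw [e, abs_mul, abs_of_pos ht'] at h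
  rw [← one_div, le_div_iff₀' ht']
  exact h

/-- The unit ball of a Lip-norm is bounded modulo scalars. -/
theorem exists_norm_sub_smul_one_le (L : LipNorm A) :
    ∃ R : ℝ, ∀ a : A, L.Le a 1 → ∃ r : ℝ, ‖a - r • (1 : A)‖ ≤ R := by
  rcases isEmpty_or_nonempty (StateSpace L.dom) with hE | ⟨⟨μ₀⟩⟩
  · refine ⟨0, fun a ha => ⟨0, ?_⟩⟩
    simpa using StateSpace.norm_le_of_forall ⟨a, ha.1⟩ le_rfl fun μ => hE.elim μ
  · obtain ⟨t, ht⟩ := L.exists_finite_net one_pos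
    choose K hK using L.exists_abs_sub_le μ₀
    have hKs : ∀ ν ∈ t, K ν ≤ ∑ ν ∈ t, |K ν| := fun ν hν =>
      (le_abs_self _).trans (Finset.single_le_sum (fun ν _ => abs_nonneg (K ν)) hν)
    have hK0 : 0 ≤ ∑ ν ∈ t, |K ν| := Finset.sum_nonneg fun ν _ => abs_nonneg (K ν)
    refine ⟨1 + ∑ ν ∈ t, |K ν|, fun a ha => ⟨μ₀.1 ⟨a, ha.1⟩, ?_⟩⟩
    refine StateSpace.norm_le_of_forall
      (⟨a, ha.1⟩ - μ₀.1 ⟨a, ha.1⟩ • ⟨1, L.dom.one_mem⟩ : L.dom.toSubmodule)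
      (c := 1 + ∑ ν ∈ t, |K ν|) (by positivity) fun μ => ?_
    obtain ⟨ν, hν, hμν⟩ := ht μ
    have h₁ := abs_le.1 (hμν _ ha.2)
    have h₂ := abs_le.1 (hK ν _ ha.2)
    have h₃ := hKs ν hν
    rw [map_sub, map_smul, μ.2.1, smul_eq_mul, mul_one, abs_le]
    constructor <;> linarith [h₁.1, h₁.2, h₂.1, h₂.2]

/-- Lip-balls of bounded norm are totally bounded. This is the Arzelà–Ascoli theorem: the elements of
the ball are `1`-Lipschitz functions on the state space, which is totally bounded for `ρ_L`. -/
theorem totallyBounded_le (L : LipNorm A) (R : ℝ) :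
    TotallyBounded {a : A | L.Le a 1 ∧ ‖a‖ ≤ R} := by
  rw [totallyBounded_iff_ultrafilter]
  intro f hf
  refine Metric.cauchy_iff.2 ⟨f.neBot, fun ε hε => ?_⟩
  obtain ⟨t, ht⟩ := L.exists_finite_net (show 0 < ε / 5 by positivity)
  classical
  -- states of `𝒟(L)` as functions on `A`; the value off the domain plays no role, since `f` is
  -- concentrated on the Lip-ball
  let g : StateSpace L.dom → A → ℝ := fun ν a =>
    if h : a ∈ L.dom.toSubmodule then ν.1 ⟨a, h⟩ else 0
  have hg : ∀ ν, ∃ c : ℝ, Tendsto (g ν) f (𝓝 c) := fun ν => by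
    have hle : (f.map (g ν) : Filter ℝ) ≤ 𝓟 (Set.Icc (-R) R) := by
      rw [le_principal_iff, Ultrafilter.coe_map, mem_map]
      filter_upwards [le_principal_iff.1 hf] with a ha
      have : g ν a = ν.1 ⟨a, ha.1.1⟩ := dif_pos ha.1.1
      rw [Set.mem_preimage, this]
      exact abs_le.1 ((StateSpace.abs_apply_le ν _).trans ha.2)
    obtain ⟨c, -, hc⟩ := isCompact_Icc.ultrafilter_le_nhds _ hle
    exact ⟨c, hc⟩
  choose c hc using hg
  have hev : ∀ᶠ a in (f : Filter A), ∀ ν ∈ t, dist (g ν a) (c ν) < ε / 5 :=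
    (Filter.eventually_all_finset t).2 fun ν _ =>
      (hc ν).eventually (Metric.ball_mem_nhds _ (by positivity))
  refine ⟨_, inter_mem (le_principal_iff.1 hf) hev, fun x hx y hy => ?_⟩
  obtain ⟨⟨hx, -⟩, hxt⟩ := hx
  obtain ⟨⟨hy, -⟩, hyt⟩ := hy
  rw [dist_eq_norm]
  refine lt_of_le_of_lt (StateSpace.norm_le_of_forall
    (⟨x, hx.1⟩ - ⟨y, hy.1⟩ : L.dom.toSubmodule) (c := 4 * (ε / 5)) (by positivity) fun μ => ?_)
    (by linarith)
  obtain ⟨ν, hν, hμν⟩ := ht μ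
  have hgx : g ν x = ν.1 ⟨x, hx.1⟩ := dif_pos hx.1
  have hgy : g ν y = ν.1 ⟨y, hy.1⟩ := dif_pos hy.1
  have h₁ := abs_le.1 (hμν _ hx.2)
  have h₂ := abs_le.1 (hμν _ hy.2)
  have h₃ := abs_lt.1 (hxt ν hν)
  have h₄ := abs_lt.1 (hyt ν hν)
  rw [hgx] at h₃
  rw [hgy] at h₄
  rw [map_sub, abs_le]
  constructor <;> linarith [h₁.1, h₁.2, h₂.1, h₂.2, h₃.1, h₃.2, h₄.1, h₄.2]

theorem isCompact_le (L : LipNorm A) (hC : 0 < C) (R : ℝ) :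
    IsCompact {a : A | L.Le a C ∧ ‖a‖ ≤ R} := by
  have h1 : IsCompact {a : A | L.Le a 1 ∧ ‖a‖ ≤ C⁻¹ * R} :=
    TotallyBounded.isCompact_of_isClosed (L.totallyBounded_le _)
      ((L.isClosed_le one_pos).inter (_root_.isClosed_le continuous_norm continuous_const))
  refine (h1.image (continuous_const_smul C)).of_isClosed_subset
    ((L.isClosed_le hC).inter (_root_.isClosed_le continuous_norm continuous_const)) ?_
  rintro a ⟨ha, haR⟩
  refine ⟨C⁻¹ • a, ⟨?_, ?_⟩, ?_⟩
  · simpa [abs_of_pos hC, hC.ne'] using ha.smul C⁻¹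
  · rw [norm_smul, Real.norm_eq_abs, abs_of_pos (inv_pos.2 hC)]
    gcongr
  · simp [smul_smul, hC.ne']

end LipNorm

end LipNorm

/-! ### Unital completely positive maps into matrices -/

section UCP

open CStarMatrix

variable {A : Type u} [CStarAlgebra A] [PartialOrder A] [StarOrderedRing A]

theorem cstarMatrix_sum_apply {m n ι R : Type*} [AddCommMonoid R] (s : Finset ι)
    (f : ι → CStarMatrix m n R) (i : m) (j : n) : (∑ x ∈ s, f x) i j = ∑ x ∈ s, f x i j := by
  induction s using Finset.cons_induction with
  | empty => simp
  | cons x s hx ih => simp [Finset.sum_cons, ih]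

/-- A version of `CStarAlgebra.nonneg_iff_eq_star_mul_self` in which the algebraic and order
structure come from the C*-algebra, so that it can be used for `CStarMatrix`. -/
theorem exists_eq_star_mul_self {B : Type*} [NonUnitalCStarAlgebra B] [PartialOrder B]
    [StarOrderedRing B] {x : B} (hx : 0 ≤ x) : ∃ y, x = star y * y :=
  CStarAlgebra.nonneg_iff_eq_star_mul_self.mp hx

theorem exists_cstarMatrix_eq_star_mul_self {B : Type*} [CStarAlgebra B] [PartialOrder B]
    [StarOrderedRing B] {k : ℕ} {M : CStarMatrix (Fin k) (Fin k) B} (hM : 0 ≤ M) :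
    ∃ N : CStarMatrix (Fin k) (Fin k) B, M = star N * N :=
  exists_eq_star_mul_self hM

/-- Gram matrices with respect to a positive functional are positive semidefinite. -/
theorem posSemidef_gram (μ : A →ₚ[ℂ] ℂ) {ι : Type*} [Fintype ι] (d : ι → A) :
    (Matrix.of fun i j => μ (star (d i) * d j)).PosSemidef := by
  refine .of_dotProduct_mulVec_nonneg ?_ fun x => ?_
  · ext i j
    rw [Matrix.conjTranspose_apply, Matrix.of_apply, Matrix.of_apply, ← map_star μ, star_mul,
      star_star]
  · have h : star x ⬝ᵥ (Matrix.of fun i j => μ (star (d i) * d j)).mulVec x =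
        μ (star (∑ i, x i • d i) * ∑ i, x i • d i) := by
      simp only [dotProduct, Matrix.mulVec, Pi.star_apply, Matrix.of_apply, star_sum, star_smul,
        Finset.sum_mul, map_sum]
      refine Finset.sum_congr rfl fun i _ => ?_
      simp only [Finset.mul_sum, map_sum, smul_mul_assoc, mul_smul_comm, map_smul, smul_eq_mul]
      refine Finset.sum_congr rfl fun j _ => ?_
      ring
    rw [h]
    exact map_nonneg μ (star_mul_self_nonneg _)

open scoped MatrixOrder in
/-- A positive semidefinite scalar matrix is positive when regarded as a block matrix. -/
theorem nonneg_block_of_posSemidef {k n : ℕ} {G : Matrix (Fin k × Fin n) (Fin k × Fin n) ℂ}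
    (hG : G.PosSemidef) :
    0 ≤ (ofMatrix (Matrix.of fun p q => ofMatrix (Matrix.of fun i j => G (p, i) (q, j))) :
      CStarMatrix (Fin k) (Fin k) (CStarMatrix (Fin n) (Fin n) ℂ)) := by
  obtain ⟨R, rfl⟩ := CStarAlgebra.nonneg_iff_eq_star_mul_self.mp hG.nonneg
  let Y : CStarMatrix (Fin k) (Fin k) (CStarMatrix (Fin n) (Fin n) ℂ) :=
    ofMatrix (Matrix.of fun r q => ofMatrix (Matrix.of fun h j => R (r, h) (q, j)))
  have hY : ofMatrix (Matrix.of fun p q => ofMatrix (Matrix.of fun i j =>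
      (star R * R) (p, i) (q, j))) = star Y * Y := by
    ext p q i j
    change (star R * R) (p, i) (q, j) = _
    rw [CStarMatrix.mul_apply, cstarMatrix_sum_apply, Matrix.mul_apply, Fintype.sum_prod_type]
    refine Finset.sum_congr rfl fun r _ => ?_
    rw [CStarMatrix.mul_apply]
    rfl
  rw [hY]
  exact star_mul_self_nonneg Y

/-- The unital completely positive map `x ↦ ∑ₛ [μ(cₛᵢ* x cₛⱼ)]ᵢⱼ` built from a positive functional
and a matrix `c` over `A` whose Gram matrix under `μ` is the identity. -/
def gramUCP {n : ℕ} (μ : A →ₚ[ℂ] ℂ) (c : Fin n → Fin n → A)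
    (hc : ∀ i j, ∑ s, μ (star (c s i) * c s j) = if i = j then 1 else 0) : UCP n A :=
  ⟨{ toFun := fun x => ofMatrix (Matrix.of fun i j => ∑ s, μ (star (c s i) * x * c s j))
     map_add' := fun x y => by
       ext i j
       change ∑ s, μ (star (c s i) * (x + y) * c s j) =
         ∑ s, μ (star (c s i) * x * c s j) + ∑ s, μ (star (c s i) * y * c s j)
       simp only [mul_add, add_mul, map_add, Finset.sum_add_distrib]
     map_smul' := fun r x => by
       ext i j
       change ∑ s, μ (star (c s i) * (r • x) * c s j) =
         r * ∑ s, μ (star (c s i) * x * c s j)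
       simp only [mul_smul_comm, smul_mul_assoc, map_smul, smul_eq_mul, Finset.mul_sum]
     map_cstarMatrix_nonneg' := fun k M hM => by
       obtain ⟨N, rfl⟩ := exists_cstarMatrix_eq_star_mul_self hM
       have hG := Matrix.posSemidef_sum (Finset.univ : Finset (Fin n × Fin k)) fun sl _ =>
         posSemidef_gram μ fun u : Fin k × Fin n => N sl.2 u.1 * c sl.1 u.2
       convert nonneg_block_of_posSemidef hG using 1
       ext p q i j
       change ∑ s, μ (star (c s i) * (star N * N) p q * c s j) = Matrix.of _ i j
       simp only [CStarMatrix.mul_apply, Matrix.of_apply, Matrix.sum_apply, Fintype.sum_prod_type,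
         Finset.mul_sum, Finset.sum_mul, map_sum, star_mul, mul_assoc, CStarMatrix.star_apply]
       rfl },
    by
      ext i j
      change ∑ s, μ (star (c s i) * 1 * c s j) = _
      simp only [mul_one, hc, CStarMatrix.one_apply]⟩

theorem gramUCP_apply {n : ℕ} (μ : A →ₚ[ℂ] ℂ) (c : Fin n → Fin n → A)
    (hc : ∀ i j, ∑ s, μ (star (c s i) * c s j) = if i = j then 1 else 0) (x : A) (i j : Fin n) :
    (gramUCP μ c hc).1 x i j = ∑ s, μ (star (c s i) * x * c s j) := rfl

/-- The unital completely positive map `x ↦ μ(x) • 1` of a state `μ`. -/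
def stateUCP (n : ℕ) (μ : A →ₚ[ℂ] ℂ) (h1 : μ 1 = 1) : UCP n A :=
  gramUCP μ (fun s i => if s = i then 1 else 0) fun i j => by
    rw [Finset.sum_eq_single i (by intro s _ hs; simp [hs]) (by simp)]
    by_cases h : i = j <;> simp [h, h1]

theorem stateUCP_apply_self {n : ℕ} (μ : A →ₚ[ℂ] ℂ) (h1 : μ 1 = 1) (x : A) (i : Fin n) :
    (stateUCP n μ h1).1 x i i = μ x := by
  rw [stateUCP, gramUCP_apply, Finset.sum_eq_single i (by intro s _ hs; simp [hs]) (by simp)]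
  simp

namespace UCP

variable {n : ℕ}

theorem norm_apply_le (φ : UCP n A) (x : A) : ‖φ.1 x‖ ≤ 2 * ‖x‖ :=
  norm_map_le_two_mul φ.1 φ.2 x

theorem norm_apply_le_of_isSelfAdjoint (φ : UCP n A) {x : A} (hx : IsSelfAdjoint x) :
    ‖φ.1 x‖ ≤ ‖x‖ :=
  norm_map_le_of_isSelfAdjoint φ.1 φ.2 hx

/-- The `j`-th diagonal entry of the inequality `Y* Y ≤ X`. -/
theorem sum_norm_sq_le_of_nonneg_sub {X Y : CStarMatrix (Fin n) (Fin n) ℂ}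
    (h : 0 ≤ X - star Y * Y) (j : Fin n) : ∑ i, ‖Y i j‖ ^ 2 ≤ (X j j).re := by
  obtain ⟨W, hW⟩ := exists_cstarMatrix_eq_star_mul_self h
  have key : ∀ Z : CStarMatrix (Fin n) (Fin n) ℂ,
      ((star Z * Z) j j).re = ∑ i, ‖Z i j‖ ^ 2 := fun Z => by
    rw [CStarMatrix.mul_apply, Complex.re_sum]
    refine Finset.sum_congr rfl fun i _ => ?_
    rw [CStarMatrix.star_apply, ← Complex.normSq_eq_norm_sq]
    simp [Complex.normSq_apply]
  have h2 := congrArg Complex.re (congrFun (congrFun hW j) j)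
  rw [CStarMatrix.sub_apply, Complex.sub_re, key, key] at h2
  have : 0 ≤ ∑ i, ‖W i j‖ ^ 2 := by positivity
  linarith

/-- The Kadison–Schwarz inequality `φ(a)* φ(a) ≤ φ(a* a)`, read off on the diagonal. -/
theorem sum_norm_sq_le (φ : UCP n A) (a : A) (j : Fin n) :
    ∑ i, ‖φ.1 a i j‖ ^ 2 ≤ (φ.1 (star a * a) j j).re := by
  refine sum_norm_sq_le_of_nonneg_sub ?_ j
  -- `N* N` is the positive matrix `[1, a; a*, a* a]`
  let N : CStarMatrix (Fin 2) (Fin 2) A := ofMatrix !![1, a; 0, 0]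
  obtain ⟨Y, hY⟩ := exists_cstarMatrix_eq_star_mul_self
    (φ.1.map_cstarMatrix_nonneg' 2 (star N * N) (star_mul_self_nonneg N))
  have hN : ∀ p q, (star N * N) p q = star (N 0 p) * N 0 q + star (N 1 p) * N 1 q := fun p q => by
    rw [CStarMatrix.mul_apply, Fin.sum_univ_two, CStarMatrix.star_apply, CStarMatrix.star_apply]
  have hYe : ∀ p q, φ.1 (star (N 0 p) * N 0 q + star (N 1 p) * N 1 q) =
      star (Y 0 p) * Y 0 q + star (Y 1 p) * Y 1 q := fun p q => by
    rw [← hN]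
    refine (congrFun (congrFun hY p) q).trans ?_
    rw [CStarMatrix.mul_apply, Fin.sum_univ_two, CStarMatrix.star_apply, CStarMatrix.star_apply]
  have e00 := hYe 0 0
  have e01 := hYe 0 1
  have e10 := hYe 1 0
  have e11 := hYe 1 1
  simp only [N, CStarMatrix.ofMatrix_apply, Matrix.of_apply, Matrix.cons_val', Matrix.cons_val_zero,
    Matrix.cons_val_one, Matrix.cons_val_fin_one, star_one, star_zero, mul_zero, add_zero, one_mul,
    mul_one, φ.2] at e00 e01 e10 e11
  have e10' : star (φ.1 a) = star (Y 0 1) * Y 0 0 + star (Y 1 1) * Y 1 0 := by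
    rw [e01]; simp
  set c := φ.1 a
  -- compress the image `Y* Y` of that matrix by the column `(-c, 1)`
  have : φ.1 (star a * a) - star c * c =
      star (Y 0 1 - Y 0 0 * c) * (Y 0 1 - Y 0 0 * c) +
      star (Y 1 1 - Y 1 0 * c) * (Y 1 1 - Y 1 0 * c) := by
    have expand : star (Y 0 1 - Y 0 0 * c) * (Y 0 1 - Y 0 0 * c) +
        star (Y 1 1 - Y 1 0 * c) * (Y 1 1 - Y 1 0 * c) =
        (star (Y 0 1) * Y 0 1 + star (Y 1 1) * Y 1 1)
        - (star (Y 0 1) * Y 0 0 + star (Y 1 1) * Y 1 0) * c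
        - star c * (star (Y 0 0) * Y 0 1 + star (Y 1 0) * Y 1 1)
        + star c * (star (Y 0 0) * Y 0 0 + star (Y 1 0) * Y 1 0) * c := by
      simp only [star_sub, star_mul]
      noncomm_ring
    rw [expand, ← e11, ← e10', ← e01, ← e00]
    noncomm_ring
  rw [this]
  exact add_nonneg (star_mul_self_nonneg _) (star_mul_self_nonneg _)

end UCP

end UCP

/-! ### A u.c.p. map adapted to a state and an element -/

section Dilation

variable {A : Type u} [CStarAlgebra A] [PartialOrder A] [StarOrderedRing A]

/-- For `n ≥ 2`, every state `μ` is a diagonal entry of a unital completely positive map into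
`Mₙ(ℂ)` whose column at `y` carries the whole of `μ(y* y)`. In terms of the GNS representation the
map is a compression to a space containing the cyclic vector `ξ` and `y ξ`. -/
theorem exists_ucp_le_sum_norm_sq {n : ℕ} (hn : 2 ≤ n) (μ : A →ₚ[ℂ] ℂ) (h1 : μ 1 = 1) (y : A) :
    ∃ (ψ : UCP n A) (j : Fin n), (∀ x, ψ.1 x j j = μ x) ∧
      (μ (star y * y)).re ≤ ∑ i, ‖ψ.1 y i j‖ ^ 2 := by
  set i₀ : Fin n := ⟨0, by omega⟩ with hi₀
  set i₁ : Fin n := ⟨1, by omega⟩ with hi₁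
  have h01 : i₀ ≠ i₁ := by simp [hi₀, hi₁]
  -- `d` is the component of `y` orthogonal to `1` for the semi-inner product `μ(x* y)`
  set m := μ y with hm
  set d := y - m • (1 : A) with hd
  have hμd : μ d = 0 := by rw [hd, map_sub, map_smul, h1, smul_eq_mul, mul_one, sub_self]
  have hμds : μ (star d) = 0 := by rw [map_star, hμd, star_zero]
  obtain ⟨t, ht0, ht⟩ : ∃ t : ℝ, 0 ≤ t ∧ μ (star d * d) = t := by
    have h := Complex.le_def.1 (map_nonneg μ (star_mul_self_nonneg d))
    exact ⟨(μ (star d * d)).re, h.1, Complex.ext rfl (by simpa using h.2.symm)⟩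
  have hyd : y = d + m • (1 : A) := by rw [hd, sub_add_cancel]
  have hdy : μ (star d * y) = t := by
    rw [hyd, mul_add, map_add, ht, mul_smul_comm, mul_one, map_smul, hμds, smul_zero, add_zero]
  have hyy : (μ (star y * y)).re = ‖m‖ ^ 2 + t := by
    have : star y * y = star d * y + star m • y := by
      conv_lhs => rw [hyd]
      rw [star_add, star_smul, star_one, add_mul, smul_mul_assoc, one_mul, ← hyd]
    rw [this, map_add, map_smul, hdy, ← hm, smul_eq_mul, ← Complex.normSq_eq_norm_sq]
    simp [Complex.normSq_apply, add_comm]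
  -- if `d` has length zero, then `μ(y* y) = |μ(y)|²` and the scalar map `x ↦ μ(x) • 1` suffices
  rcases ht0.eq_or_lt with h0 | h0
  · refine ⟨stateUCP n μ h1, i₀, fun x => stateUCP_apply_self μ h1 x i₀, ?_⟩
    rw [hyy, ← h0, add_zero]
    refine le_trans (le_of_eq ?_) (Finset.single_le_sum
      (f := fun i => ‖(stateUCP n μ h1).1 y i i₀‖ ^ 2) (fun i _ => by positivity)
      (Finset.mem_univ i₀))
    simp only [stateUCP_apply_self, hm]
  · set r : ℝ := (Real.sqrt t)⁻¹ with hr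
    have hsq : Real.sqrt t * Real.sqrt t = t := Real.mul_self_sqrt ht0
    have hs0 : Real.sqrt t ≠ 0 := (Real.sqrt_pos.2 h0).ne'
    have hrt : r * t = Real.sqrt t := by rw [hr, inv_mul_eq_iff_eq_mul₀ hs0, hsq]
    have hrrt : r * (r * t) = 1 := by rw [hrt, hr, inv_mul_cancel₀ hs0]
    -- `ψ(x)` has entry `μ(eᵢ* x eⱼ)` where `σ i = σ j` and `0` elsewhere: the indices `i₀` and `i₁`,
    -- carrying the orthonormal pair `1`, `d / √t`, form one block
    let e : Fin n → A := fun i => if i = i₁ then (r : ℂ) • d else 1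
    let σ : Fin n → Fin n := fun i => if i = i₁ then i₀ else i
    have he₀ : e i₀ = 1 := if_neg h01
    have he₁ : e i₁ = (r : ℂ) • d := if_pos rfl
    have hσ₀ : σ i₀ = i₀ := if_neg h01
    have hσ₁ : σ i₁ = i₀ := if_pos rfl
    have hsum : ∀ (x : A) (i j : Fin n), ∑ s, μ (star (if s = σ i then e i else 0) * x *
        (if s = σ j then e j else 0)) = if σ i = σ j then μ (star (e i) * x * e j) else 0 :=
      fun x i j => by
        rw [Finset.sum_eq_single (σ i) (by intro s _ hs; simp [hs]) (by simp)]
        by_cases h : σ i = σ j <;> simp [h]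
    have hc : ∀ i j, ∑ s, μ (star (if s = σ i then e i else 0) * (if s = σ j then e j else 0)) =
        if i = j then 1 else 0 := fun i j => by
      have := hsum 1 i j
      simp only [mul_one] at this
      rw [this]
      by_cases hi : i = i₁ <;> by_cases hj : j = i₁
      · subst hi
        simp only [hj, he₁, if_true, star_smul, smul_mul_smul_comm, map_smul, ht, smul_eq_mul]
        simp only [Complex.star_def, Complex.conj_ofReal, ← Complex.ofReal_mul, mul_assoc, hrrt,
          Complex.ofReal_one]
      · subst hi
        have hej : e j = 1 := if_neg hj
        simp [hej, he₁, hμds, Ne.symm hj]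
      · subst hj
        have hei : e i = 1 := if_neg hi
        simp [hei, he₁, hμd, hi]
      · have hej : e j = 1 := if_neg hj
        have hei : e i = 1 := if_neg hi
        have hsi : σ i = i := if_neg hi
        have hsj : σ j = j := if_neg hj
        simp [hei, hej, hsi, hsj, h1]
    set ψ := gramUCP μ (fun s i => if s = σ i then e i else 0) hc with hψ
    refine ⟨ψ, i₀, fun x => ?_, ?_⟩
    · rw [hψ, gramUCP_apply, hsum, if_pos rfl, he₀]
      simp
    · have hle : ∑ i ∈ {i₀, i₁}, ‖ψ.1 y i i₀‖ ^ 2 ≤ ∑ i, ‖ψ.1 y i i₀‖ ^ 2 :=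
        Finset.sum_le_sum_of_subset_of_nonneg (Finset.subset_univ _) fun i _ _ => by positivity
      refine le_trans (le_of_eq ?_) hle
      rw [Finset.sum_pair h01, hψ, gramUCP_apply, gramUCP_apply, hsum, hsum, if_pos rfl,
        if_pos (hσ₁.trans hσ₀.symm), he₀, he₁, hyy]
      simp only [star_one, one_mul, mul_one, star_smul, smul_mul_assoc, map_smul, hdy, smul_eq_mul,
        Complex.star_def, Complex.conj_ofReal, ← Complex.ofReal_mul, hrt, Complex.norm_real,
        Real.norm_eq_abs, sq_abs, Real.sq_sqrt ht0, hm]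

end Dilation

/-! ### Isometric linear relations and Kadison–Schwarz isomorphisms -/

section Graph

open Filter Topology

variable {A : Type u} [CStarAlgebra A] {B : Type v} [CStarAlgebra B]

/-- A closed linear relation which is isometric has closed domain and closed range. -/
theorem isClosed_fst_image_of_norm_eq {E F : Type*} [NormedAddCommGroup E] [NormedSpace ℝ E]
    [CompleteSpace E] [NormedAddCommGroup F] [NormedSpace ℝ F] [CompleteSpace F]
    {G : Submodule ℝ (E × F)} (hG : IsClosed (G : Set (E × F)))
    (hnorm : ∀ p ∈ G, ‖p.1‖ = ‖p.2‖) :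
    IsClosed (Prod.fst '' (G : Set (E × F))) ∧ IsClosed (Prod.snd '' (G : Set (E × F))) := by
  have : CompleteSpace G := hG.completeSpace_coe
  have h₁ : Isometry (LinearMap.fst ℝ E F ∘ₗ G.subtype) :=
    AddMonoidHomClass.isometry_of_norm _ fun p => by
      change ‖(p : E × F).1‖ = max ‖(p : E × F).1‖ ‖(p : E × F).2‖
      rw [← hnorm p p.2, max_self]
  have h₂ : Isometry (LinearMap.snd ℝ E F ∘ₗ G.subtype) :=
    AddMonoidHomClass.isometry_of_norm _ fun p => by
      change ‖(p : E × F).2‖ = max ‖(p : E × F).1‖ ‖(p : E × F).2‖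
      rw [← hnorm p p.2, max_self]
  constructor
  · convert h₁.isClosedEmbedding.isClosed_range using 1
    ext x
    simp
  · convert h₂.isClosedEmbedding.isClosed_range using 1
    ext x
    simp

/-- The complex-linear relation whose real and imaginary parts lie in a real-linear relation. -/
def complexGraph (G : Submodule ℝ (A × B)) : Submodule ℂ (A × B) where
  carrier := {p | ((realPart p.1 : A), (realPart p.2 : B)) ∈ G ∧
    ((imaginaryPart p.1 : A), (imaginaryPart p.2 : B)) ∈ G}
  add_mem' := fun {p q} hp hq => by
    refine ⟨?_, ?_⟩
    · simpa using G.add_mem hp.1 hq.1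
    · simpa using G.add_mem hp.2 hq.2
  zero_mem' := by
    refine ⟨?_, ?_⟩ <;> (simp only [Prod.fst_zero, Prod.snd_zero, map_zero]; exact G.zero_mem)
  smul_mem' := fun c p hp => by
    refine ⟨?_, ?_⟩
    · simpa [realPart_smul] using G.sub_mem (G.smul_mem c.re hp.1) (G.smul_mem c.im hp.2)
    · simpa [imaginaryPart_smul] using G.add_mem (G.smul_mem c.re hp.2) (G.smul_mem c.im hp.1)

/-- An isometric real-linear relation between the self-adjoint parts, with full domain and full
range, is the graph of the self-adjoint part of a `*`-preserving complex-linear bijection. -/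
theorem exists_linearEquiv_of_graph {G : Submodule ℝ (A × B)}
    (hsa : ∀ p ∈ G, IsSelfAdjoint p.1 ∧ IsSelfAdjoint p.2) (hnorm : ∀ p ∈ G, ‖p.1‖ = ‖p.2‖)
    (hl : ∀ a : A, IsSelfAdjoint a → ∃ b, (a, b) ∈ G)
    (hr : ∀ b : B, IsSelfAdjoint b → ∃ a, (a, b) ∈ G) :
    ∃ Φ : A ≃ₗ[ℂ] B, (∀ p ∈ G, Φ p.1 = p.2) ∧ (∀ a, IsSelfAdjoint a → (a, Φ a) ∈ G) ∧
      ∀ a, Φ (star a) = star (Φ a) := by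
  have hmem : ∀ p ∈ G, p ∈ complexGraph G := fun p hp => by
    obtain ⟨h₁, h₂⟩ := hsa p hp
    refine ⟨?_, ?_⟩
    · simpa [h₁.coe_realPart, h₂.coe_realPart] using hp
    · simp only [h₁.imaginaryPart, h₂.imaginaryPart]
      exact G.zero_mem
  have hlift : ∀ {a₁ a₂ : A} {b₁ b₂ : B}, (a₁, b₁) ∈ G → (a₂, b₂) ∈ G →
      (a₁ + Complex.I • a₂, b₁ + Complex.I • b₂) ∈ complexGraph G := fun h₁ h₂ =>
    (complexGraph G).add_mem (hmem _ h₁) ((complexGraph G).smul_mem Complex.I (hmem _ h₂))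
  have hzero : ∀ p ∈ complexGraph G, p.1 = 0 ↔ p.2 = 0 := fun p hp => by
    have e₁ := hnorm _ hp.1
    have e₂ := hnorm _ hp.2
    simp only at e₁ e₂
    constructor
    · intro h
      rw [h] at e₁ e₂
      rw [← realPart_add_I_smul_imaginaryPart p.2]
      simp only [map_zero, ZeroMemClass.coe_zero, norm_zero] at e₁ e₂
      rw [norm_eq_zero.1 e₁.symm, norm_eq_zero.1 e₂.symm]
      simp
    · intro h
      rw [h] at e₁ e₂
      rw [← realPart_add_I_smul_imaginaryPart p.1]
      simp only [map_zero, ZeroMemClass.coe_zero, norm_zero] at e₁ e₂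
      rw [norm_eq_zero.1 e₁, norm_eq_zero.1 e₂]
      simp
  have hinj : ∀ p q : complexGraph G, (p : A × B).1 = (q : A × B).1 ↔
      (p : A × B).2 = (q : A × B).2 := fun p q => by
    have := hzero _ (p - q).2
    simpa [sub_eq_zero] using this
  obtain ⟨Φ, hΦ⟩ := Submodule.exists_equiv_eq_graph (G := complexGraph G)
    ⟨fun p q h => Subtype.ext (Prod.ext h ((hinj p q).1 h)), fun a => by
      obtain ⟨b₁, hb₁⟩ := hl _ (realPart a).2
      obtain ⟨b₂, hb₂⟩ := hl _ (imaginaryPart a).2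
      exact ⟨⟨_, hlift hb₁ hb₂⟩, realPart_add_I_smul_imaginaryPart a⟩⟩
    ⟨fun p q h => Subtype.ext (Prod.ext ((hinj p q).2 h) h), fun b => by
      obtain ⟨a₁, ha₁⟩ := hr _ (realPart b).2
      obtain ⟨a₂, ha₂⟩ := hr _ (imaginaryPart b).2
      exact ⟨⟨_, hlift ha₁ ha₂⟩, realPart_add_I_smul_imaginaryPart b⟩⟩
  have hgraph : ∀ p ∈ complexGraph G, Φ p.1 = p.2 := fun p hp => by
    rw [hΦ, LinearMap.mem_graph_iff] at hp
    exact hp.symm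
  have hsaΦ : ∀ a, IsSelfAdjoint a → (a, Φ a) ∈ G := fun a ha => by
    obtain ⟨b, hb⟩ := hl a ha
    rwa [hgraph _ (hmem _ hb)]
  refine ⟨Φ, fun p hp => hgraph p (hmem p hp), hsaΦ, fun a => ?_⟩
  have h₁ := (hsa _ (hsaΦ _ (realPart a).2)).2.star_eq
  have h₂ := (hsa _ (hsaΦ _ (imaginaryPart a).2)).2.star_eq
  simp only at h₁ h₂
  conv_lhs => rw [← realPart_add_I_smul_imaginaryPart a]
  conv_rhs => rw [← realPart_add_I_smul_imaginaryPart a]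
  rw [star_add, star_smul, (realPart a).2.star_eq, (imaginaryPart a).2.star_eq, map_add, map_smul,
    map_add, map_smul, star_add, star_smul, h₁, h₂]

/-- A `*`-preserving linear bijection which satisfies the Kadison–Schwarz inequality together with
its inverse is multiplicative. -/
theorem map_mul_of_schwarz [PartialOrder A] [StarOrderedRing A] [PartialOrder B]
    [StarOrderedRing B] (Φ : A ≃ₗ[ℂ] B) (hstar : ∀ a, Φ (star a) = star (Φ a))
    (hmono : ∀ a, 0 ≤ a → 0 ≤ Φ a)
    (h₁ : ∀ a, star (Φ a) * Φ a ≤ Φ (star a * a))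
    (h₂ : ∀ b, star (Φ.symm b) * Φ.symm b ≤ Φ.symm (star b * b)) (a b : A) :
    Φ (a * b) = Φ a * Φ b := by
  have hq : ∀ a, Φ (star a * a) - star (Φ a) * Φ a = 0 := fun a => by
    refine sub_eq_zero.2 (le_antisymm ?_ (h₁ a))
    have h := hmono _ (sub_nonneg.2 (h₂ (Φ a)))
    rw [map_sub, LinearEquiv.apply_symm_apply, LinearEquiv.symm_apply_apply] at h
    exact sub_nonneg.1 h
  have hpol : ∀ x y,
      (Φ (star x * y) - star (Φ x) * Φ y) + (Φ (star y * x) - star (Φ y) * Φ x) = 0 :=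
    fun x y => by
      have e := hq (x + y)
      have e₁ := hq x
      have e₂ := hq y
      simp only [star_add, map_add, add_mul, mul_add] at e
      calc _ = (Φ (star x * x) + Φ (star y * x) + (Φ (star x * y) + Φ (star y * y)) -
            (star (Φ x) * Φ x + star (Φ y) * Φ x + (star (Φ x) * Φ y + star (Φ y) * Φ y))) -
            (Φ (star x * x) - star (Φ x) * Φ x) - (Φ (star y * y) - star (Φ y) * Φ y) := by abel
        _ = 0 := by rw [e, e₁, e₂]; simp
  have hz : ∀ x y, Φ (star x * y) - star (Φ x) * Φ y = 0 := fun x y => by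
    have e₁ := hpol x y
    have e₂ := hpol x (Complex.I • y)
    simp only [mul_smul_comm, map_smul, star_smul, smul_mul_assoc, Complex.star_def,
      Complex.conj_I] at e₂
    rw [← smul_sub, ← smul_sub, neg_smul, ← sub_eq_add_neg, ← smul_sub] at e₂
    have e₃ := (smul_eq_zero.1 e₂).resolve_left Complex.I_ne_zero
    have e₄ : (2 : ℂ) • (Φ (star x * y) - star (Φ x) * Φ y) = 0 := by
      rw [two_smul]
      calc _ = ((Φ (star x * y) - star (Φ x) * Φ y) + (Φ (star y * x) - star (Φ y) * Φ x)) +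
          ((Φ (star x * y) - star (Φ x) * Φ y) - (Φ (star y * x) - star (Φ y) * Φ x)) := by abel
        _ = 0 := by rw [e₁, e₃, add_zero]
    exact (smul_eq_zero.1 e₄).resolve_left two_ne_zero
  have := sub_eq_zero.1 (hz (star a) b)
  rwa [star_star, hstar, star_star] at this

end Graph

/-! ### Limits along a free ultrafilter -/

section Limit

open Filter Topology

/-- The limit along a free ultrafilter of a sequence of relations `rel k`, with uniform control of
the constant. -/
def limRel {X Y : Type*} [TopologicalSpace X] [TopologicalSpace Y]
    (rel : ℕ → ℝ → X → Y → Prop) (x : X) (y : Y) : Prop :=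
  ∃ (C : ℝ) (x' : ℕ → X) (y' : ℕ → Y), (∀ k, rel k C (x' k) (y' k)) ∧
    Tendsto x' (hyperfilter ℕ) (𝓝 x) ∧ Tendsto y' (hyperfilter ℕ) (𝓝 y)

theorem limRel_symm {X Y : Type*} [TopologicalSpace X] [TopologicalSpace Y]
    {rel : ℕ → ℝ → X → Y → Prop} {x : X} {y : Y} (h : limRel rel x y) :
    limRel (fun k C y x => rel k C x y) y x := by
  obtain ⟨C, x', y', hr, hx, hy⟩ := h
  exact ⟨C, y', x', hr, hy, hx⟩

theorem tendsto_inv_add_one_mul (C : ℝ) :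
    Tendsto (fun k : ℕ => ((k : ℝ) + 1)⁻¹ * C) (hyperfilter ℕ) (𝓝 0) := by
  have h : Tendsto (fun k : ℕ => ((k : ℝ) + 1)⁻¹) (hyperfilter ℕ) (𝓝 0) := by
    have := (tendsto_one_div_add_atTop_nhds_zero_nat (𝕜 := ℝ)).mono_left Nat.hyperfilter_le_atTop
    simpa using this
  simpa using h.mul_const C

end Limit

/-! ### Bridges and their limits -/

section Bridge

open Filter Topology

variable {A : Type u} [CStarAlgebra A] [PartialOrder A] [StarOrderedRing A]
variable {B : Type v} [CStarAlgebra B] [PartialOrder B] [StarOrderedRing B]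

/-- The properties of the relation `rel C a b`, meaning `L(a, b) ≤ C`, for a Lip-norm `L` which
induces `L_A` and `L_B` and for which the sets of u.c.p. maps of `A` and `B` into `Mₙ(ℂ)` are
`ε`-close. They are symmetric in `A` and `B`. -/
structure IsBridge (LA : LipNorm A) (LB : LipNorm B) (n : ℕ) (ε : ℝ) (rel : ℝ → A → B → Prop) :
    Prop where
  add : ∀ {C C' a a' b b'}, rel C a b → rel C' a' b' → rel (C + C') (a + a') (b + b')
  mono : ∀ {C C' a b}, rel C a b → C ≤ C' → rel C' a b
  smul : ∀ {C a b} (r : ℝ), rel C a b → rel (|r| * C) (r • a) (r • b)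
  one : rel 0 1 1
  left_le : ∀ {C a b}, rel C a b → LA.Le a C
  right_le : ∀ {C a b}, rel C a b → LB.Le b C
  exists_right : ∀ {C δ a}, LA.Le a C → 0 < δ → ∃ b, rel (C + δ) a b
  exists_left : ∀ {C δ b}, LB.Le b C → 0 < δ → ∃ a, rel (C + δ) a b
  exists_ucp_left : ∀ ψ : UCP n B, ∃ φ : UCP n A, ∀ C a b, rel C a b → ‖φ.1 a - ψ.1 b‖ ≤ ε * C
  exists_ucp_right : ∀ φ : UCP n A, ∃ ψ : UCP n B, ∀ C a b, rel C a b → ‖φ.1 a - ψ.1 b‖ ≤ ε * C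

variable {LA : LipNorm A} {LB : LipNorm B} {n : ℕ}

theorem LipNorm.Le.nonneg {a : A} {C : ℝ} (h : LA.Le a C) : 0 ≤ C :=
  (apply_nonneg LA.toSeminorm _).trans h.2

namespace IsBridge

variable {ε : ℝ} {rel : ℝ → A → B → Prop}

theorem symm (h : IsBridge LA LB n ε rel) : IsBridge LB LA n ε fun C b a => rel C a b where
  add := h.add
  mono := h.mono
  smul := h.smul
  one := h.one
  left_le := h.right_le
  right_le := h.left_le
  exists_right := h.exists_left
  exists_left := h.exists_right
  exists_ucp_left := fun φ => (h.exists_ucp_right φ).imp fun ψ hψ C b a hr => by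
    rw [norm_sub_rev]; exact hψ C a b hr
  exists_ucp_right := fun ψ => (h.exists_ucp_left ψ).imp fun φ hφ C b a hr => by
    rw [norm_sub_rev]; exact hφ C a b hr

/-- Partners have almost the same norm, since scalar u.c.p. maps `x ↦ μ(x) • 1` recover the norm of
self-adjoint elements. -/
theorem norm_right_le (h : IsBridge LA LB n ε rel) (hn : 1 ≤ n) (hε : 0 ≤ ε) {C : ℝ} {a : A} {b : B}
    (hr : rel C a b) : ‖b‖ ≤ ‖a‖ + ε * C := by
  have hC : 0 ≤ C := (h.left_le hr).nonneg
  refine norm_le_of_forall_state (h.right_le hr).isSelfAdjoint (by positivity) fun μ h1 => ?_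
  obtain ⟨φ, hφ⟩ := h.exists_ucp_left (stateUCP n μ h1)
  have h₁ := hφ C a b hr
  have h₂ : ‖φ.1 a‖ ≤ ‖a‖ := φ.norm_apply_le_of_isSelfAdjoint (h.left_le hr).isSelfAdjoint
  have h₃ : |(μ b).re| ≤ ‖(stateUCP n μ h1).1 b‖ := by
    rw [← stateUCP_apply_self (n := n) μ h1 b ⟨0, hn⟩]
    exact (Complex.abs_re_le_norm _).trans CStarMatrix.norm_entry_le_norm
  have h₄ : ‖(stateUCP n μ h1).1 b‖ ≤ ‖φ.1 a‖ + ‖φ.1 a - (stateUCP n μ h1).1 b‖ := by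
    have := norm_sub_le (φ.1 a) (φ.1 a - (stateUCP n μ h1).1 b)
    rwa [sub_sub_cancel] at this
  linarith

end IsBridge

/-- A sequence of bridges whose widths tend to zero. -/
abbrev IsBridgeSeq (LA : LipNorm A) (LB : LipNorm B) (n : ℕ) (rel : ℕ → ℝ → A → B → Prop) : Prop :=
  ∀ k : ℕ, IsBridge LA LB n ((k : ℝ) + 1)⁻¹ (rel k)

namespace IsBridgeSeq

variable {rel : ℕ → ℝ → A → B → Prop}

theorem symm (h : IsBridgeSeq LA LB n rel) : IsBridgeSeq LB LA n fun k C b a => rel k C a b :=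
  fun k => (h k).symm

theorem norm_right_le_of_limRel (h : IsBridgeSeq LA LB n rel) (hn : 1 ≤ n) {a : A} {b : B}
    (hab : limRel rel a b) : ‖b‖ ≤ ‖a‖ := by
  obtain ⟨C, a', b', hr, ha, hb⟩ := hab
  have h₁ := ha.norm.add (tendsto_inv_add_one_mul C)
  rw [add_zero] at h₁
  exact le_of_tendsto_of_tendsto hb.norm h₁
    (Eventually.of_forall fun k => (h k).norm_right_le hn (by positivity) (hr k))

theorem norm_eq_of_limRel (h : IsBridgeSeq LA LB n rel) (hn : 1 ≤ n) {a : A} {b : B}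
    (hab : limRel rel a b) : ‖a‖ = ‖b‖ :=
  le_antisymm (h.symm.norm_right_le_of_limRel hn (limRel_symm hab))
    (h.norm_right_le_of_limRel hn hab)

/-- Lip-bounded elements have limit partners, by compactness of Lip-balls. -/
theorem exists_limRel_right (h : IsBridgeSeq LA LB n rel) (hn : 1 ≤ n) {a : A} {C : ℝ}
    (ha : LA.Le a C) :
    ∃ b, LB.Le b C ∧ limRel rel a b := by
  have hC := ha.nonneg
  have hδ : ∀ k : ℕ, 0 < ((k : ℝ) + 1)⁻¹ := fun k => by positivity
  have hδ1 : ∀ k : ℕ, ((k : ℝ) + 1)⁻¹ ≤ 1 := fun k =>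
    inv_le_one_of_one_le₀ (by linarith [k.cast_nonneg (α := ℝ)])
  choose b' hb' using fun k => (h k).exists_right ha (hδ k)
  have hle : ((hyperfilter ℕ).map b' : Filter B) ≤
      𝓟 {b | LB.Le b (C + 1) ∧ ‖b‖ ≤ ‖a‖ + (C + 1)} := by
    rw [le_principal_iff, Ultrafilter.coe_map, mem_map]
    refine Eventually.of_forall fun k => ⟨((h k).right_le (hb' k)).mono (by linarith [hδ1 k]), ?_⟩
    refine ((h k).norm_right_le hn (hδ k).le (hb' k)).trans ?_
    have : ((k : ℝ) + 1)⁻¹ * (C + ((k : ℝ) + 1)⁻¹) ≤ 1 * (C + 1) := by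
      gcongr
      · exact hδ1 k
      · exact hδ1 k
    linarith
  obtain ⟨b, -, hb⟩ := (LB.isCompact_le (by linarith : 0 < C + 1) _).ultrafilter_le_nhds _ hle
  have hbt : Tendsto b' (hyperfilter ℕ) (𝓝 b) := hb
  have hbC : ∀ δ : ℝ, 0 < δ → LB.Le b (C + δ) := fun δ hδ0 => by
    refine (LB.isClosed_le (by linarith)).mem_of_tendsto hbt ?_
    have := (tendsto_inv_add_one_mul 1).eventually (gt_mem_nhds hδ0)
    filter_upwards [this] with k hk
    exact ((h k).right_le (hb' k)).mono (by linarith)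
  refine ⟨b, ⟨(hbC 1 one_pos).1, le_of_forall_pos_le_add fun δ hδ0 => (hbC δ hδ0).2⟩,
    C + 1, fun _ => a, b', fun k => (h k).mono (hb' k) (by linarith [hδ1 k]),
    tendsto_const_nhds, hbt⟩

/-- The limit relation as a real-linear subspace. -/
def graph (h : IsBridgeSeq LA LB n rel) : Submodule ℝ (A × B) where
  carrier := {p | limRel rel p.1 p.2}
  add_mem' := by
    rintro p q ⟨C, a, b, hr, ha, hb⟩ ⟨C', a', b', hr', ha', hb'⟩
    exact ⟨C + C', _, _, fun k => (h k).add (hr k) (hr' k), ha.add ha', hb.add hb'⟩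
  zero_mem' := ⟨0, fun _ => 0, fun _ => 0, fun k => by simpa using (h k).smul 0 (h k).one,
    tendsto_const_nhds, tendsto_const_nhds⟩
  smul_mem' := by
    rintro r p ⟨C, a, b, hr, ha, hb⟩
    exact ⟨|r| * C, _, _, fun k => (h k).smul r (hr k), ha.const_smul r, hb.const_smul r⟩

/-- The closure of the limit relation is the graph of an isometry of `A_sa` onto `B_sa`. -/
theorem exists_mem_closure (h : IsBridgeSeq LA LB n rel) (hn : 1 ≤ n) :
    (∀ p ∈ h.graph.topologicalClosure, IsSelfAdjoint p.1 ∧ IsSelfAdjoint p.2) ∧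
    (∀ p ∈ h.graph.topologicalClosure, ‖p.1‖ = ‖p.2‖) ∧
    (∀ a : A, IsSelfAdjoint a → ∃ b, (a, b) ∈ h.graph.topologicalClosure) ∧
    (∀ b : B, IsSelfAdjoint b → ∃ a, (a, b) ∈ h.graph.topologicalClosure) := by
  have hsa : ∀ p ∈ h.graph.topologicalClosure, IsSelfAdjoint p.1 ∧ IsSelfAdjoint p.2 := by
    have hcl : IsClosed {p : A × B | IsSelfAdjoint p.1 ∧ IsSelfAdjoint p.2} :=
      (isClosed_eq (continuous_star.comp continuous_fst) continuous_fst).inter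
        (isClosed_eq (continuous_star.comp continuous_snd) continuous_snd)
    refine fun p hp => closure_minimal (fun q hq => ?_) hcl hp
    obtain ⟨C, a, b, hr, ha, hb⟩ := hq
    exact ⟨(isClosed_eq continuous_star continuous_id).mem_of_tendsto ha
        (Eventually.of_forall fun k => ((h k).left_le (hr k)).isSelfAdjoint),
      (isClosed_eq continuous_star continuous_id).mem_of_tendsto hb
        (Eventually.of_forall fun k => ((h k).right_le (hr k)).isSelfAdjoint)⟩
  have hnorm : ∀ p ∈ h.graph.topologicalClosure, ‖p.1‖ = ‖p.2‖ := by
    have hcl : IsClosed {p : A × B | ‖p.1‖ = ‖p.2‖} :=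
      isClosed_eq continuous_fst.norm continuous_snd.norm
    exact fun p hp => closure_minimal (fun q hq => h.norm_eq_of_limRel hn hq) hcl hp
  obtain ⟨h₁, h₂⟩ :=
    isClosed_fst_image_of_norm_eq h.graph.isClosed_topologicalClosure hnorm
  refine ⟨hsa, hnorm, fun a ha => ?_, fun b hb => ?_⟩
  · have hsub : (LA.dom.toSubmodule : Set A) ⊆
        Prod.fst '' (h.graph.topologicalClosure : Set (A × B)) := fun x hx => by
      obtain ⟨b, -, hb⟩ := h.exists_limRel_right hn (LA.le_of_mem ⟨x, hx⟩)
      exact ⟨(x, b), h.graph.le_topologicalClosure hb, rfl⟩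
    obtain ⟨p, hp, rfl⟩ := closure_minimal hsub h₁ (LA.dense_dom a ha)
    exact ⟨p.2, hp⟩
  · have hsub : (LB.dom.toSubmodule : Set B) ⊆
        Prod.snd '' (h.graph.topologicalClosure : Set (A × B)) := fun x hx => by
      obtain ⟨a, -, ha⟩ := h.symm.exists_limRel_right hn (LB.le_of_mem ⟨x, hx⟩)
      exact ⟨(a, x), h.graph.le_topologicalClosure (limRel_symm ha), rfl⟩
    obtain ⟨p, hp, rfl⟩ := closure_minimal hsub h₂ (LB.dense_dom b hb)
    exact ⟨p.1, hp⟩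

/-- Every u.c.p. map on `B`, composed with a map whose self-adjoint part has its graph in the
closure of the limit relation, is a pointwise limit of u.c.p. maps on `A`. -/
theorem exists_tendsto_ucp (h : IsBridgeSeq LA LB n rel) {T : A →ₗ[ℂ] B}
    (hT : ∀ a, IsSelfAdjoint a → (a, T a) ∈ closure {p : A × B | limRel rel p.1 p.2})
    (ψ : UCP n B) :
    ∃ φ : ℕ → UCP n A, ∀ a, Tendsto (fun k => (φ k).1 a) (hyperfilter ℕ) (𝓝 (ψ.1 (T a))) := by
  choose φ hφ using fun k => (h k).exists_ucp_left ψ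
  have hlim : ∀ p : A × B, limRel rel p.1 p.2 →
      Tendsto (fun k => (φ k).1 p.1) (hyperfilter ℕ) (𝓝 (ψ.1 p.2)) := by
    rintro ⟨a, b⟩ ⟨C, a', b', hr, ha, hb⟩
    rw [tendsto_iff_norm_sub_tendsto_zero] at ha hb ⊢
    have hsum := ((ha.const_mul 2).add (tendsto_inv_add_one_mul C)).add (hb.const_mul 2)
    simp only [mul_zero, add_zero] at hsum
    refine squeeze_zero (fun k => norm_nonneg _) (fun k => ?_) hsum
    have e : (φ k).1 a - ψ.1 b = -(φ k).1 (a' k - a) + ((φ k).1 (a' k) - ψ.1 (b' k)) +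
        ψ.1 (b' k - b) := by
      rw [map_sub, map_sub]; abel
    change ‖(φ k).1 a - ψ.1 b‖ ≤ _
    rw [e]
    refine norm_add₃_le.trans ?_
    rw [norm_neg]
    exact add_le_add (add_le_add ((φ k).norm_apply_le _) (hφ k C _ _ (hr k))) (ψ.norm_apply_le _)
  have hsa : ∀ a, IsSelfAdjoint a →
      Tendsto (fun k => (φ k).1 a) (hyperfilter ℕ) (𝓝 (ψ.1 (T a))) := fun a ha => by
    rw [Metric.tendsto_nhds]
    intro ε hε
    obtain ⟨p, hp, hpd⟩ := Metric.mem_closure_iff.1 (hT a ha) (ε / 5) (by positivity)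
    rw [Prod.dist_eq, max_lt_iff, dist_eq_norm, dist_eq_norm] at hpd
    filter_upwards [(hlim p hp).eventually (Metric.ball_mem_nhds _ (by positivity : 0 < ε / 5))]
      with k hk
    have hk' : ‖(φ k).1 p.1 - ψ.1 p.2‖ < ε / 5 := by rw [← dist_eq_norm]; exact hk
    have e : (φ k).1 a - ψ.1 (T a) = (φ k).1 (a - p.1) + ((φ k).1 p.1 - ψ.1 p.2) -
        ψ.1 (T a - p.2) := by
      rw [map_sub, map_sub]; abel
    rw [dist_eq_norm, e]
    have h₁ := norm_sub_le ((φ k).1 (a - p.1) + ((φ k).1 p.1 - ψ.1 p.2)) (ψ.1 (T a - p.2))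
    have h₂ := norm_add_le ((φ k).1 (a - p.1)) ((φ k).1 p.1 - ψ.1 p.2)
    have h₃ := (φ k).norm_apply_le (a - p.1)
    have h₄ := ψ.norm_apply_le (T a - p.2)
    have h₅ : ‖a - p.1‖ < ε / 5 := hpd.1
    have h₆ : ‖T a - p.2‖ < ε / 5 := hpd.2
    linarith
  refine ⟨φ, fun a => ?_⟩
  have := (hsa _ (realPart a).2).add ((hsa _ (imaginaryPart a).2).const_smul Complex.I)
  simp only [← map_smul, ← map_add, realPart_add_I_smul_imaginaryPart] at this
  exact this

/-- The Kadison–Schwarz inequality for a limit of bridges of level at least two. It is tested on a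
state `μ` of `B` through a u.c.p. map which has `μ` as a diagonal entry. -/
theorem star_mul_self_le (h : IsBridgeSeq LA LB n rel) (hn : 2 ≤ n) {T : A →ₗ[ℂ] B}
    (hstar : ∀ a, T (star a) = star (T a))
    (hT : ∀ a, IsSelfAdjoint a → (a, T a) ∈ closure {p : A × B | limRel rel p.1 p.2}) (a : A) :
    star (T a) * T a ≤ T (star a * a) := by
  rw [← sub_nonneg]
  have hsa : IsSelfAdjoint (T (star a * a)) := by
    rw [IsSelfAdjoint, ← hstar, star_mul, star_star]
  refine nonneg_of_forall_state (hsa.sub (IsSelfAdjoint.star_mul_self _)) fun μ h1 => ?_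
  obtain ⟨ψ, j, hψ, hle⟩ := exists_ucp_le_sum_norm_sq hn μ h1 (T a)
  obtain ⟨φ, hφ⟩ := h.exists_tendsto_ucp hT ψ
  have hentry : ∀ x i, Tendsto (fun k => (φ k).1 x i j) (hyperfilter ℕ) (𝓝 (ψ.1 (T x) i j)) :=
    fun x i => by
      rw [tendsto_iff_norm_sub_tendsto_zero]
      refine squeeze_zero (fun k => norm_nonneg _) (fun k => ?_)
        (tendsto_iff_norm_sub_tendsto_zero.1 (hφ x))
      exact CStarMatrix.norm_entry_le_norm (M := (φ k).1 x - ψ.1 (T x))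
  have hlim : ∑ i, ‖ψ.1 (T a) i j‖ ^ 2 ≤ (ψ.1 (T (star a * a)) j j).re :=
    le_of_tendsto_of_tendsto (tendsto_finsetSum _ fun i _ => ((hentry a i).norm.pow 2))
      ((Complex.continuous_re.tendsto _).comp (hentry (star a * a) j))
      (Eventually.of_forall fun k => (φ k).sum_norm_sq_le a j)
  rw [hψ] at hlim
  rw [map_sub, Complex.sub_re, sub_nonneg]
  exact hle.trans hlim

/-- Limit partners satisfy `L_B(Φ(a)) ≤ L_A(a)`; the reverse inequality comes from the partner of
`Φ(a)` in `A`, which is `a` itself. -/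
theorem lipIsometric (h : IsBridgeSeq LA LB n rel) (hn : 1 ≤ n) {Φ : A → B} {Ψ : B → A}
    (hΦ : ∀ a b, limRel rel a b → Φ a = b) (hΨ : ∀ a b, limRel rel a b → Ψ b = a) :
    LipIsometric LA LB Φ := fun a => by
  obtain ⟨b, hb, hab⟩ := h.exists_limRel_right hn (LA.le_of_mem a)
  obtain ⟨a', ha', hab'⟩ := h.symm.exists_limRel_right hn (LB.le_of_mem ⟨b, hb.1⟩)
  have e : a' = a := by rw [← hΨ _ _ (limRel_symm hab'), hΨ _ _ hab]
  subst e
  have e' := hΦ _ _ hab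
  subst e'
  exact ⟨hb.1, le_antisymm hb.2 ha'.2⟩

/-- A sequence of bridges whose widths tend to zero yields a bi-Lip-isometric unital order
isomorphism, which is multiplicative if the bridges have level at least two. -/
theorem exists_linearEquiv (h : IsBridgeSeq LA LB n rel) (hn : 1 ≤ n) :
    ∃ Φ : A ≃ₗ[ℂ] B, IsUnitalOrderIso Φ ∧ BiLipIsometric LA LB Φ.toEquiv ∧
      (∀ a, Φ (star a) = star (Φ a)) ∧ (2 ≤ n → ∀ a b, Φ (a * b) = Φ a * Φ b) := by
  obtain ⟨hsa, hnorm, hl, hr⟩ := h.exists_mem_closure hn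
  obtain ⟨Φ, hΦ, hΦsa, hstar⟩ := exists_linearEquiv_of_graph hsa hnorm hl hr
  have hΨsa : ∀ b, IsSelfAdjoint b → (Φ.symm b, b) ∈ h.graph.topologicalClosure := fun b hb => by
    obtain ⟨a, ha⟩ := hr b hb
    have := hΦ _ ha
    simp only at this
    rwa [← this, LinearEquiv.symm_apply_apply, this]
  have hlim : ∀ a b, limRel rel a b → Φ a = b := fun a b hab =>
    hΦ (a, b) (h.graph.le_topologicalClosure hab)
  have hlim' : ∀ a b, limRel rel a b → Φ.symm b = a := fun a b hab => by
    rw [← hlim a b hab, LinearEquiv.symm_apply_apply]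
  have hone : Φ 1 = 1 :=
    hlim 1 1 ⟨0, fun _ => 1, fun _ => 1, fun k => (h k).one, tendsto_const_nhds, tendsto_const_nhds⟩
  have hnormΦ : ∀ a, IsSelfAdjoint a → ‖a‖ = ‖Φ a‖ := fun a ha => hnorm _ (hΦsa a ha)
  have hpos : ∀ a, IsSelfAdjoint a → (0 ≤ a ↔ 0 ≤ Φ a) := fun a ha => by
    rw [nonneg_iff_norm_smul_one_sub_le ha,
      nonneg_iff_norm_smul_one_sub_le (hsa _ (hΦsa a ha)).2, ← hnormΦ a ha,
      hnormΦ _ (((IsSelfAdjoint.all ‖a‖).smul (IsSelfAdjoint.one A)).sub ha), map_sub,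
      ← Complex.coe_smul, map_smul, hone, Complex.coe_smul]
  have hmono : ∀ a, 0 ≤ a → 0 ≤ Φ a := fun a ha => (hpos a (.of_nonneg ha)).1 ha
  refine ⟨Φ, ⟨hone, hmono, fun b hb => ?_⟩, ⟨?_, ?_⟩, hstar, fun hn2 => ?_⟩
  · refine (hpos _ (hsa _ (hΨsa b (.of_nonneg hb))).1).2 ?_
    rwa [LinearEquiv.apply_symm_apply]
  · exact h.lipIsometric hn hlim hlim'
  · exact h.symm.lipIsometric hn (fun b a hab => hlim' a b (limRel_symm hab))
      fun b a hab => hlim a b (limRel_symm hab)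
  · have hstar' : ∀ b, Φ.symm (star b) = star (Φ.symm b) := fun b => by
      rw [LinearEquiv.symm_apply_eq, hstar, LinearEquiv.apply_symm_apply]
    refine map_mul_of_schwarz Φ hstar hmono ?_ ?_
    · exact h.star_mul_self_le hn2 (T := Φ.toLinearMap) hstar hΦsa
    · refine h.symm.star_mul_self_le hn2 (T := Φ.symm.toLinearMap) hstar' fun b hb => ?_
      have hmem : Homeomorph.prodComm B A (b, Φ.symm b) ∈
          closure {p : A × B | limRel rel p.1 p.2} :=
        hΨsa b hb
      rw [← Set.mem_preimage, (Homeomorph.prodComm B A).preimage_closure] at hmem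
      exact closure_mono (fun p hp => limRel_symm hp) hmem

end IsBridgeSeq

end Bridge

/-! ### Bridges from small distance -/

section Induced

open Filter Topology

variable {A : Type u} [CStarAlgebra A] [PartialOrder A] [StarOrderedRing A]
variable {B : Type v} [CStarAlgebra B] [PartialOrder B] [StarOrderedRing B]
variable {LA : LipNorm A} {LB : LipNorm B} {n : ℕ}

theorem LipNorm.ucpMetric_edist_le_iff (L : LipNorm A) {φ ψ : UCP n A} {ε : ℝ} (hε : 0 ≤ ε) :
    (L.ucpMetric n).edist φ ψ ≤ ENNReal.ofReal ε ↔ ∀ x, L.Le x 1 → ‖φ.1 x - ψ.1 x‖ ≤ ε := by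
  change (⨆ (x : L.dom.toSubmodule) (_ : L.toSeminorm x ≤ 1),
    edist (φ.1 (x : A)) (ψ.1 (x : A))) ≤ _ ↔ _
  simp only [iSup_le_iff, edist_dist, dist_eq_norm, ENNReal.ofReal_le_ofReal_iff hε]
  exact ⟨fun h x hx => h ⟨x, hx.1⟩ hx.2, fun h x hx => h x ⟨x.2, hx⟩⟩

/-- The bound `‖φ(x) - ψ(x)‖ ≤ ε L(x)` also covers `L(x) = 0`, through constants `C' > C`. -/
theorem LipNorm.norm_sub_le_of_edist_lt (L : LipNorm A) {φ ψ : UCP n A} {ε : ℝ} (hε : 0 < ε)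
    (h : (L.ucpMetric n).edist φ ψ < ENNReal.ofReal ε) {x : A} {C : ℝ} (hx : L.Le x C) :
    ‖φ.1 x - ψ.1 x‖ ≤ ε * C := by
  have h1 := (L.ucpMetric_edist_le_iff hε.le).1 h.le
  refine le_of_forall_pos_le_add fun δ hδ => ?_
  have hC := hx.nonneg
  have hC' : 0 < C + δ / ε := by positivity
  have h2 := h1 _ ((hx.smul (C + δ / ε)⁻¹).mono (by
    rw [abs_of_pos (inv_pos.2 hC'), inv_mul_le_iff₀ hC', mul_one]
    linarith [div_pos hδ hε]))
  rw [← Complex.coe_smul, map_smul, map_smul, ← smul_sub, norm_smul, Complex.norm_real,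
    Real.norm_eq_abs, abs_of_pos (inv_pos.2 hC'), inv_mul_le_iff₀ hC'] at h2
  refine h2.trans (le_of_eq ?_)
  field_simp

namespace Induces

variable {L : LipNorm (A × B)}

theorem left_le (hL : Induces L LA LB) {a : A} {b : B} {C : ℝ} (h : L.Le (a, b) C) :
    LA.Le a C := by
  have hm := (hL.mem_dom_iff (a, b)).1 h.1
  exact ⟨hm.1, ((hL.quotient_left ⟨a, hm.1⟩).1 ⟨⟨(a, b), h.1⟩, rfl, rfl⟩).trans h.2⟩

theorem right_le (hL : Induces L LA LB) {a : A} {b : B} {C : ℝ} (h : L.Le (a, b) C) :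
    LB.Le b C := by
  have hm := (hL.mem_dom_iff (a, b)).1 h.1
  exact ⟨hm.2, ((hL.quotient_right ⟨b, hm.2⟩).1 ⟨⟨(a, b), h.1⟩, rfl, rfl⟩).trans h.2⟩

theorem exists_right (hL : Induces L LA LB) {a : A} {C δ : ℝ} (ha : LA.Le a C) (hδ : 0 < δ) :
    ∃ b, L.Le (a, b) (C + δ) := by
  obtain ⟨r, ⟨⟨⟨a', b⟩, hp⟩, hpa, hpr⟩, hr⟩ := (isGLB_lt_iff (hL.quotient_left ⟨a, ha.1⟩)).1
    (ha.2.trans_lt (lt_add_of_pos_right C hδ))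
  obtain rfl : a' = a := hpa
  exact ⟨b, hp, hpr.le.trans hr.le⟩

theorem exists_left (hL : Induces L LA LB) {b : B} {C δ : ℝ} (hb : LB.Le b C) (hδ : 0 < δ) :
    ∃ a, L.Le (a, b) (C + δ) := by
  obtain ⟨r, ⟨⟨⟨a, b'⟩, hp⟩, hpb, hpr⟩, hr⟩ := (isGLB_lt_iff (hL.quotient_right ⟨b, hb.1⟩)).1
    (hb.2.trans_lt (lt_add_of_pos_right C hδ))
  obtain rfl : b' = b := hpb
  exact ⟨a, hp, hpr.le.trans hr.le⟩

end Induces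

theorem LipNorm.exists_edist_lt_left {L : LipNorm (A × B)} {r : ℝ≥0∞} (h : L.ucpHausdorff n < r)
    (ψ : UCP n B) : ∃ φ : UCP n A, (L.ucpMetric n).edist (φ.comp (StarAlgHom.fst ℂ A B))
      (ψ.comp (StarAlgHom.snd ℂ A B)) < r := by
  let := L.ucpMetric n
  have h' : Metric.hausdorffEDist (ucpRight A B n) (ucpLeft A B n) < r := by
    rw [Metric.hausdorffEDist_comm]
    exact h
  have hψ : ψ.comp (StarAlgHom.snd ℂ A B) ∈ ucpRight A B n := Set.mem_range_self ψ
  obtain ⟨χ, hχ, hφ⟩ := Metric.exists_edist_lt_of_hausdorffEDist_lt hψ h'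
  obtain ⟨φ, rfl⟩ : ∃ φ : UCP n A, φ.comp (StarAlgHom.fst ℂ A B) = χ := hχ
  rw [edist_comm] at hφ
  exact ⟨φ, hφ⟩

theorem LipNorm.exists_edist_lt_right {L : LipNorm (A × B)} {r : ℝ≥0∞} (h : L.ucpHausdorff n < r)
    (φ : UCP n A) : ∃ ψ : UCP n B, (L.ucpMetric n).edist (φ.comp (StarAlgHom.fst ℂ A B))
      (ψ.comp (StarAlgHom.snd ℂ A B)) < r := by
  let := L.ucpMetric n
  have h' : Metric.hausdorffEDist (ucpLeft A B n) (ucpRight A B n) < r := h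
  have hφ : φ.comp (StarAlgHom.fst ℂ A B) ∈ ucpLeft A B n := Set.mem_range_self φ
  obtain ⟨χ, hχ, hψ⟩ := Metric.exists_edist_lt_of_hausdorffEDist_lt hφ h'
  obtain ⟨ψ, rfl⟩ : ∃ ψ : UCP n B, ψ.comp (StarAlgHom.snd ℂ A B) = χ := hχ
  exact ⟨ψ, hψ⟩

theorem LipNorm.norm_sub_le_of_edist_comp_lt {L : LipNorm (A × B)} {ε : ℝ} (hε : 0 < ε)
    {φ : UCP n A} {ψ : UCP n B} (h : (L.ucpMetric n).edist (φ.comp (StarAlgHom.fst ℂ A B))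
      (ψ.comp (StarAlgHom.snd ℂ A B)) < ENNReal.ofReal ε) (C : ℝ) (a : A) (b : B)
    (hab : L.Le (a, b) C) : ‖φ.1 a - ψ.1 b‖ ≤ ε * C := by
  have := L.norm_sub_le_of_edist_lt hε h hab
  exact this

theorem isBridge_of_induces {L : LipNorm (A × B)} (hL : Induces L LA LB) {ε : ℝ} (hε : 0 < ε)
    (h : L.ucpHausdorff n < ENNReal.ofReal ε) :
    IsBridge LA LB n ε fun C a b => L.Le (a, b) C where
  add := fun h h' => h.add h'
  mono := fun h hC => h.mono hC
  smul := fun r h => h.smul r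
  one := by
    have := L.le_smul_one 1
    rw [one_smul] at this
    exact this
  left_le := hL.left_le
  right_le := hL.right_le
  exists_right := hL.exists_right
  exists_left := hL.exists_left
  exists_ucp_left := fun ψ => (L.exists_edist_lt_left h ψ).imp fun _ hφ =>
    L.norm_sub_le_of_edist_comp_lt hε hφ
  exists_ucp_right := fun φ => (L.exists_edist_lt_right h φ).imp fun _ hψ =>
    L.norm_sub_le_of_edist_comp_lt hε hψ

theorem exists_isBridgeSeq (h : nDist n LA LB = 0) :
    ∃ rel : ℕ → ℝ → A → B → Prop, IsBridgeSeq LA LB n rel := by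
  have : ∀ k : ℕ, ∃ rel : ℝ → A → B → Prop, IsBridge LA LB n ((k : ℝ) + 1)⁻¹ rel := fun k => by
    have hε : 0 < ((k : ℝ) + 1)⁻¹ := by positivity
    have hlt : nDist n LA LB < ENNReal.ofReal ((k : ℝ) + 1)⁻¹ := by
      rw [h]
      exact ENNReal.ofReal_pos.2 hε
    simp only [nDist, iInf_lt_iff] at hlt
    obtain ⟨L, hL, hlt⟩ := hlt
    exact ⟨_, isBridge_of_induces hL hε hlt⟩
  choose rel hrel using this
  exact ⟨rel, hrel⟩

end Induced

/-! ### Small distance from isomorphisms -/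

section Converse

open Filter Topology

variable {A : Type u} [CStarAlgebra A] [PartialOrder A] [StarOrderedRing A]
variable {B : Type v} [CStarAlgebra B] [PartialOrder B] [StarOrderedRing B]
variable {LA : LipNorm A} {LB : LipNorm B} {n : ℕ}

namespace IsUnitalOrderIso

variable {Φ : A ≃ₗ[ℂ] B}

theorem continuous (h : IsUnitalOrderIso Φ) : Continuous Φ :=
  map_continuous (PositiveLinearMap.mk₀ (Φ : A →ₗ[ℂ] B) h.map_nonneg)

theorem isSelfAdjoint_map (h : IsUnitalOrderIso Φ) {a : A} (ha : IsSelfAdjoint a) :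
    IsSelfAdjoint (Φ a) :=
  ha.map' (PositiveLinearMap.mk₀ (Φ : A →ₗ[ℂ] B) h.map_nonneg)

theorem norm_map_le (h : IsUnitalOrderIso Φ) {a : A} (ha : IsSelfAdjoint a) : ‖Φ a‖ ≤ ‖a‖ :=
  norm_map_le_of_isSelfAdjoint (PositiveLinearMap.mk₀ (Φ : A →ₗ[ℂ] B) h.map_nonneg) h.map_one ha

end IsUnitalOrderIso

/-- The order-unit subspace `𝒟(L_A) ⊕ 𝒟(L_B)`. -/
def prodDom (LA : LipNorm A) (LB : LipNorm B) : OrderUnitSubspace (A × B) where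
  toSubmodule := LA.dom.toSubmodule.prod LB.dom.toSubmodule
  isSelfAdjoint_of_mem := fun _ hp => Prod.ext (LA.dom.isSelfAdjoint_of_mem _ hp.1)
    (LB.dom.isSelfAdjoint_of_mem _ hp.2)
  one_mem := ⟨LA.dom.one_mem, LB.dom.one_mem⟩

/-- The seminorm `max(L_A(a), L_B(b), ‖Φ(a) - b‖ / ε)`. -/
def bridgeSeminorm (LA : LipNorm A) (LB : LipNorm B) (Φ : A ≃ₗ[ℂ] B) (ε : ℝ) :
    Seminorm ℝ (prodDom LA LB).toSubmodule :=
  LA.toSeminorm.comp ((LinearMap.fst ℝ A B ∘ₗ (prodDom LA LB).toSubmodule.subtype).codRestrict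
      LA.dom.toSubmodule fun x => x.2.1) ⊔
    (LB.toSeminorm.comp ((LinearMap.snd ℝ A B ∘ₗ (prodDom LA LB).toSubmodule.subtype).codRestrict
      LB.dom.toSubmodule fun x => x.2.2) ⊔
    (normSeminorm ℝ B).comp (ε⁻¹ • (((Φ : A →ₗ[ℂ] B).restrictScalars ℝ ∘ₗ LinearMap.fst ℝ A B -
      LinearMap.snd ℝ A B) ∘ₗ (prodDom LA LB).toSubmodule.subtype)))

theorem bridgeSeminorm_le_iff {Φ : A ≃ₗ[ℂ] B} {ε : ℝ} (hε : 0 < ε)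
    (x : (prodDom LA LB).toSubmodule) {C : ℝ} :
    bridgeSeminorm LA LB Φ ε x ≤ C ↔ LA.Le (x : A × B).1 C ∧ LB.Le (x : A × B).2 C ∧
      ‖Φ (x : A × B).1 - (x : A × B).2‖ ≤ ε * C := by
  have e : ‖ε⁻¹ • (Φ (x : A × B).1 - (x : A × B).2)‖ ≤ C ↔
      ‖Φ (x : A × B).1 - (x : A × B).2‖ ≤ ε * C := by
    rw [norm_smul, Real.norm_eq_abs, abs_of_pos (inv_pos.2 hε), inv_mul_le_iff₀ hε]
  rw [← e]
  change max (LA.toSeminorm ⟨(x : A × B).1, x.2.1⟩) (max (LB.toSeminorm ⟨(x : A × B).2, x.2.2⟩)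
    ‖ε⁻¹ • (Φ (x : A × B).1 - (x : A × B).2)‖) ≤ C ↔ _
  rw [max_le_iff, max_le_iff]
  exact ⟨fun ⟨h₁, h₂, h₃⟩ => ⟨⟨x.2.1, h₁⟩, ⟨x.2.2, h₂⟩, h₃⟩,
    fun ⟨h₁, h₂, h₃⟩ => ⟨h₁.2, h₂.2, h₃⟩⟩

theorem le_bridgeSeminorm {Φ : A ≃ₗ[ℂ] B} {ε : ℝ} (hε : 0 < ε)
    (x : (prodDom LA LB).toSubmodule) :
    LA.toSeminorm ⟨(x : A × B).1, x.2.1⟩ ≤ bridgeSeminorm LA LB Φ ε x ∧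
      LB.toSeminorm ⟨(x : A × B).2, x.2.2⟩ ≤ bridgeSeminorm LA LB Φ ε x := by
  obtain ⟨h₁, h₂, -⟩ := (bridgeSeminorm_le_iff (Φ := Φ) hε x).1 le_rfl
  exact ⟨h₁.2, h₂.2⟩

theorem exists_bridgeSeminorm_le_iff {Φ : A ≃ₗ[ℂ] B} {ε : ℝ} (hε : 0 < ε) (p : A × B) {C : ℝ} :
    (∃ h : p ∈ (prodDom LA LB).toSubmodule, bridgeSeminorm LA LB Φ ε ⟨p, h⟩ ≤ C) ↔
      LA.Le p.1 C ∧ LB.Le p.2 C ∧ ‖Φ p.1 - p.2‖ ≤ ε * C :=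
  ⟨fun ⟨h, hC⟩ => (bridgeSeminorm_le_iff hε ⟨p, h⟩).1 hC,
    fun h => ⟨⟨h.1.mem, h.2.1.mem⟩, (bridgeSeminorm_le_iff hε ⟨p, _⟩).2 h⟩⟩

theorem bridgeSeminorm_eq_zero_iff {Φ : A ≃ₗ[ℂ] B} (hΦ : IsUnitalOrderIso Φ) {ε : ℝ} (hε : 0 < ε)
    (x : (prodDom LA LB).toSubmodule) :
    bridgeSeminorm LA LB Φ ε x = 0 ↔ ∃ r : ℝ, (x : A × B) = r • (1 : A × B) := by
  rw [← (apply_nonneg _ x).ge_iff_eq', bridgeSeminorm_le_iff hε, mul_zero, norm_le_zero_iff,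
    sub_eq_zero]
  constructor
  · rintro ⟨h₁, -, h₃⟩
    obtain ⟨r, hr⟩ := (LA.eq_zero_iff _).1 (le_antisymm h₁.2 (apply_nonneg _ _))
    refine ⟨r, Prod.ext hr ?_⟩
    simp only at hr
    rw [← h₃, hr, ← Complex.coe_smul, map_smul, hΦ.map_one]
    simp
  · rintro ⟨r, hr⟩
    rw [hr]
    refine ⟨LA.le_smul_one r, LB.le_smul_one r, ?_⟩
    change Φ (r • (1 : A)) = r • (1 : B)
    rw [← Complex.coe_smul, map_smul, hΦ.map_one, Complex.coe_smul]

/-- The seminorm `max(L_A(a), L_B(b), ‖Φ(a) - b‖ / ε)` is a Lip-norm. -/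
def bridgeLipNorm (LA : LipNorm A) (LB : LipNorm B) {Φ : A ≃ₗ[ℂ] B} (hΦ : IsUnitalOrderIso Φ)
    {ε : ℝ} (hε : 0 < ε) : LipNorm (A × B) where
  dom := prodDom LA LB
  dense_dom := fun p hp => by
    have h : p ∈ closure (LA.dom.toSubmodule : Set A) ×ˢ closure (LB.dom.toSubmodule : Set B) :=
      ⟨LA.dense_dom _ (congrArg Prod.fst hp), LB.dense_dom _ (congrArg Prod.snd hp)⟩
    rw [← closure_prod_eq] at h
    exact h
  toSeminorm := bridgeSeminorm LA LB Φ ε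
  eq_zero_iff := bridgeSeminorm_eq_zero_iff hΦ hε
  topology_eq := by
    refine StateSpace.topology_eq_of_totallyBounded _ _
      (fun r => (bridgeSeminorm_eq_zero_iff hΦ hε _).2 ⟨r, rfl⟩) (fun R => ?_) ?_
    · have hK := (LA.isCompact_le one_pos R).prod (LB.isCompact_le one_pos R)
      refine hK.totallyBounded.subset ?_
      rintro p ⟨hp, hR⟩
      rw [exists_bridgeSeminorm_le_iff hε] at hp
      exact ⟨⟨hp.1, (norm_fst_le p).trans hR⟩, ⟨hp.2.1, (norm_snd_le p).trans hR⟩⟩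
    · obtain ⟨R, hR⟩ := LA.exists_norm_sub_smul_one_le
      refine ⟨R + ε, fun x hx => ?_⟩
      obtain ⟨h₁, -, h₃⟩ := (bridgeSeminorm_le_iff hε x).1 hx
      obtain ⟨r, hr⟩ := hR _ h₁
      refine ⟨r, ?_⟩
      have hsa : IsSelfAdjoint ((x : A × B).1 - r • (1 : A)) :=
        h₁.isSelfAdjoint.sub (LA.le_smul_one r).isSelfAdjoint
      have h₄ := (hΦ.norm_map_le hsa).trans hr
      rw [map_sub, ← Complex.coe_smul, map_smul, hΦ.map_one, Complex.coe_smul] at h₄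
      have h₅ : (x : A × B).2 - r • (1 : B) =
          (Φ (x : A × B).1 - r • (1 : B)) - (Φ (x : A × B).1 - (x : A × B).2) := by abel
      refine max_le (hr.trans (by linarith)) ?_
      change ‖(x : A × B).2 - r • (1 : B)‖ ≤ R + ε
      rw [h₅]
      exact (norm_sub_le _ _).trans (by linarith)
  isClosed_ball := by
    simp only [exists_bridgeSeminorm_le_iff hε]
    refine ((LA.isClosed_le one_pos).preimage continuous_fst).inter
      (((LB.isClosed_le one_pos).preimage continuous_snd).inter
        (show IsClosed {p : A × B | ‖Φ p.1 - p.2‖ ≤ ε * 1} from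
        isClosed_le ?_ continuous_const))
    exact ((hΦ.continuous.comp continuous_fst).sub continuous_snd).norm

theorem bridgeLipNorm_le_iff {Φ : A ≃ₗ[ℂ] B} (hΦ : IsUnitalOrderIso Φ) {ε : ℝ} (hε : 0 < ε)
    (p : A × B) {C : ℝ} : (bridgeLipNorm LA LB hΦ hε).Le p C ↔
      LA.Le p.1 C ∧ LB.Le p.2 C ∧ ‖Φ p.1 - p.2‖ ≤ ε * C :=
  exists_bridgeSeminorm_le_iff hε p

/-- The infima which define the quotient seminorms are attained on the graph of `Φ`. -/
theorem induces_bridgeLipNorm {Φ : A ≃ₗ[ℂ] B} (hΦ : IsUnitalOrderIso Φ) {ε : ℝ} (hε : 0 < ε)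
    (hLip : BiLipIsometric LA LB Φ.toEquiv) : Induces (bridgeLipNorm LA LB hΦ hε) LA LB where
  mem_dom_iff := fun _ => Iff.rfl
  quotient_left := fun a => by
    refine IsLeast.isGLB ⟨?_, ?_⟩
    · obtain ⟨hm, he⟩ := hLip.1 a
      have hle : bridgeSeminorm LA LB Φ ε ⟨((a : A), Φ a), a.2, hm⟩ ≤ LA.toSeminorm a :=
        (bridgeSeminorm_le_iff hε _).2 ⟨LA.le_of_mem a, ⟨hm, he.le⟩, by
          simpa using mul_nonneg hε.le (apply_nonneg LA.toSeminorm a)⟩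
      exact ⟨⟨((a : A), Φ a), a.2, hm⟩, rfl,
        le_antisymm hle (le_bridgeSeminorm hε ⟨((a : A), Φ a), a.2, hm⟩).1⟩
    · rintro r ⟨⟨⟨a', b⟩, hp⟩, hpa, rfl⟩
      obtain rfl : a' = a := hpa
      exact (le_bridgeSeminorm (Φ := Φ) hε ⟨((a : A), b), hp⟩).1
  quotient_right := fun b => by
    refine IsLeast.isGLB ⟨?_, ?_⟩
    · obtain ⟨hm, he⟩ := hLip.2 b
      have hle : bridgeSeminorm LA LB Φ ε ⟨(Φ.symm (b : B), (b : B)), hm, b.2⟩ ≤ LB.toSeminorm b :=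
        (bridgeSeminorm_le_iff hε _).2 ⟨⟨hm, he.le⟩, LB.le_of_mem b, by
          simpa using mul_nonneg hε.le (apply_nonneg LB.toSeminorm b)⟩
      exact ⟨⟨(Φ.symm (b : B), (b : B)), hm, b.2⟩, rfl,
        le_antisymm hle (le_bridgeSeminorm hε ⟨(Φ.symm (b : B), (b : B)), hm, b.2⟩).2⟩
    · rintro r ⟨⟨⟨a, b'⟩, hp⟩, hpb, rfl⟩
      obtain rfl : b' = b := hpb
      exact (le_bridgeSeminorm (Φ := Φ) hε ⟨(a, (b : B)), hp⟩).2

/-- If `Φ` matches the u.c.p. maps of `A` and `B`, matched maps are `ε`-close, because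
`ψ(Φ(a)) - ψ(b) = ψ(Φ(a) - b)`. -/
theorem ucpHausdorff_bridgeLipNorm_le {Φ : A ≃ₗ[ℂ] B} (hΦ : IsUnitalOrderIso Φ) {ε : ℝ}
    (hε : 0 < ε) (h₁ : ∀ φ : UCP n A, ∃ ψ : UCP n B, ∀ b, ψ.1 b = φ.1 (Φ.symm b))
    (h₂ : ∀ ψ : UCP n B, ∃ φ : UCP n A, ∀ a, φ.1 a = ψ.1 (Φ a)) :
    (bridgeLipNorm LA LB hΦ hε).ucpHausdorff n ≤ ENNReal.ofReal ε := by
  have key : ∀ (φ : UCP n A) (ψ : UCP n B), (∀ a, φ.1 a = ψ.1 (Φ a)) →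
      ((bridgeLipNorm LA LB hΦ hε).ucpMetric n).edist (φ.comp (StarAlgHom.fst ℂ A B))
        (ψ.comp (StarAlgHom.snd ℂ A B)) ≤ ENNReal.ofReal ε := fun φ ψ h => by
    refine ((bridgeLipNorm LA LB hΦ hε).ucpMetric_edist_le_iff hε.le).2 fun p hp => ?_
    obtain ⟨ha, hb, hab⟩ := (bridgeLipNorm_le_iff hΦ hε p).1 hp
    change ‖φ.1 p.1 - ψ.1 p.2‖ ≤ ε
    rw [h, ← map_sub]
    refine (ψ.norm_apply_le_of_isSelfAdjoint
      ((hΦ.isSelfAdjoint_map ha.isSelfAdjoint).sub hb.isSelfAdjoint)).trans ?_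
    simpa using hab
  let := (bridgeLipNorm LA LB hΦ hε).ucpMetric n
  refine Metric.hausdorffEDist_le_of_mem_edist ?_ ?_
  · rintro _ ⟨φ, rfl⟩
    obtain ⟨ψ, hψ⟩ := h₁ φ
    exact ⟨_, ⟨ψ, rfl⟩, key φ ψ fun a => by rw [hψ, LinearEquiv.symm_apply_apply]⟩
  · rintro _ ⟨ψ, rfl⟩
    obtain ⟨φ, hφ⟩ := h₂ ψ
    refine ⟨_, ⟨φ, rfl⟩, ?_⟩
    rw [edist_comm]
    exact key φ ψ hφ

/-- Positive unital maps pull back u.c.p. maps into `M₁(ℂ)`, because positive functionals are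
completely positive. -/
theorem exists_ucp_one_comp {T : A →ₗ[ℂ] B} (hT : ∀ a, 0 ≤ a → 0 ≤ T a) (h1 : T 1 = 1)
    (ψ : UCP 1 B) : ∃ φ : UCP 1 A, ∀ a, φ.1 a = ψ.1 (T a) := by
  have hpos : ∀ a, 0 ≤ a → 0 ≤ ψ.1 (T a) 0 0 := fun a ha => by
    obtain ⟨W, hW⟩ := exists_cstarMatrix_eq_star_mul_self (map_nonneg ψ.1 (hT a ha))
    rw [hW, CStarMatrix.mul_apply]
    exact Finset.sum_nonneg fun i _ => star_mul_self_nonneg (W i 0)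
  let μ : A →ₚ[ℂ] ℂ := PositiveLinearMap.mk₀
    { toFun := fun a => ψ.1 (T a) 0 0
      map_add' := fun a b => by simp
      map_smul' := fun c a => by simp } hpos
  have hμ : μ 1 = 1 := by
    change ψ.1 (T 1) 0 0 = 1
    rw [h1, ψ.2, CStarMatrix.one_apply_eq]
  refine ⟨stateUCP 1 μ hμ, fun a => ?_⟩
  ext i j
  rw [Subsingleton.elim i 0, Subsingleton.elim j 0, stateUCP_apply_self]
  rfl

theorem nDist_eq_zero_of_linearEquiv {Φ : A ≃ₗ[ℂ] B} (hΦ : IsUnitalOrderIso Φ)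
    (hLip : BiLipIsometric LA LB Φ.toEquiv) : nDist 1 LA LB = 0 := by
  refine le_antisymm (ENNReal.le_of_forall_pos_le_add fun ε hε _ => ?_) zero_le
  rw [zero_add, ← ENNReal.ofReal_coe_nnreal]
  exact (iInf₂_le (f := fun L (_ : Induces L LA LB) => L.ucpHausdorff 1) _
    (induces_bridgeLipNorm hΦ hε hLip)).trans
    (ucpHausdorff_bridgeLipNorm_le hΦ hε
      (exists_ucp_one_comp (T := (Φ.symm : B →ₗ[ℂ] A)) hΦ.symm_map_nonneg
        (by rw [LinearEquiv.coe_coe, LinearEquiv.symm_apply_eq, hΦ.map_one]))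
      (exists_ucp_one_comp (T := (Φ : A →ₗ[ℂ] B)) hΦ.map_nonneg hΦ.map_one))

theorem completeDist_eq_zero_of_starAlgEquiv (Φ : A ≃⋆ₐ[ℂ] B)
    (hLip : BiLipIsometric LA LB Φ.toEquiv) : completeDist LA LB = 0 := by
  let Φ' : A ≃ₗ[ℂ] B := Φ.toAlgEquiv.toLinearEquiv
  have hΦ : IsUnitalOrderIso Φ' :=
    ⟨map_one Φ, fun a ha => map_nonneg Φ ha, fun b hb => map_nonneg Φ.symm hb⟩
  refine le_antisymm (ENNReal.le_of_forall_pos_le_add fun ε hε _ => ?_) zero_le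
  rw [zero_add, ← ENNReal.ofReal_coe_nnreal]
  refine (iInf₂_le (f := fun L (_ : Induces L LA LB) => ⨆ (n : ℕ) (_ : 1 ≤ n), L.ucpHausdorff n) _
    (induces_bridgeLipNorm (Φ := Φ') hΦ hε hLip)).trans (iSup₂_le fun n _ => ?_)
  exact ucpHausdorff_bridgeLipNorm_le hΦ hε
    (fun φ => ⟨φ.comp (Φ.symm : B →⋆ₐ[ℂ] A), fun b => rfl⟩)
    (fun ψ => ⟨ψ.comp (Φ : A →⋆ₐ[ℂ] B), fun a => rfl⟩)

theorem nDist_le_completeDist (hn : 1 ≤ n) : nDist n LA LB ≤ completeDist LA LB :=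
  iInf₂_mono fun L _ => le_iSup₂ (f := fun (n : ℕ) (_ : 1 ≤ n) => L.ucpHausdorff n) n hn

theorem exists_starAlgEquiv_of_nDist_eq_zero (hn : 2 ≤ n) (h : nDist n LA LB = 0) :
    ∃ Φ : A ≃⋆ₐ[ℂ] B, BiLipIsometric LA LB Φ.toEquiv := by
  obtain ⟨rel, hrel⟩ := exists_isBridgeSeq h
  obtain ⟨Φ, -, hLip, hstar, hmul⟩ := IsBridgeSeq.exists_linearEquiv hrel (by omega)
  exact ⟨{ Φ.toEquiv with
    map_mul' := hmul hn
    map_add' := Φ.map_add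
    map_star' := hstar
    map_smul' := Φ.map_smul }, hLip⟩

end Converse

end LipQGH

end

theorem mainTheorem2
    {A : Type u} [CStarAlgebra A] [PartialOrder A] [StarOrderedRing A]
    {B : Type v} [CStarAlgebra B] [PartialOrder B] [StarOrderedRing B]
    (LA : LipQGH.LipNorm A) (LB : LipQGH.LipNorm B) :
    (LipQGH.nDist 1 LA LB = 0 ↔
      ∃ Φ : A ≃ₗ[ℂ] B, LipQGH.IsUnitalOrderIso Φ ∧ LipQGH.BiLipIsometric LA LB Φ.toEquiv) ∧
    (∀ n : ℕ, 2 ≤ n →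
      (LipQGH.nDist n LA LB = 0 ↔
        ∃ Φ : A ≃⋆ₐ[ℂ] B, LipQGH.BiLipIsometric LA LB Φ.toEquiv)) ∧
    (LipQGH.completeDist LA LB = 0 ↔
      ∃ Φ : A ≃⋆ₐ[ℂ] B, LipQGH.BiLipIsometric LA LB Φ.toEquiv) := by
  refine ⟨⟨fun h => ?_, fun ⟨Φ, hΦ, hLip⟩ => LipQGH.nDist_eq_zero_of_linearEquiv hΦ hLip⟩,
    fun n hn => ⟨LipQGH.exists_starAlgEquiv_of_nDist_eq_zero hn, fun ⟨Φ, hLip⟩ => ?_⟩,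
    fun h => ?_, fun ⟨Φ, hLip⟩ => LipQGH.completeDist_eq_zero_of_starAlgEquiv Φ hLip⟩
  · obtain ⟨rel, hrel⟩ := LipQGH.exists_isBridgeSeq h
    obtain ⟨Φ, hΦ, hLip, -⟩ := LipQGH.IsBridgeSeq.exists_linearEquiv hrel le_rfl
    exact ⟨Φ, hΦ, hLip⟩
  · exact le_antisymm ((LipQGH.nDist_le_completeDist (by omega)).trans
      (LipQGH.completeDist_eq_zero_of_starAlgEquiv Φ hLip).le) zero_le
  · exact LipQGH.exists_starAlgEquiv_of_nDist_eq_zero le_rfl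
      (le_antisymm ((LipQGH.nDist_le_completeDist one_le_two).trans h.le) zero_le)
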